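/- \textbf{Theorem (Regular Language Recognition).} \emph{Model.} Let $\Sigma$ be a finite alphabet and let $\mathrm{BoS},\$\notin\Sigma$ be two further symbols. An $(s,r,t)$-universal transformer over the vocabulary $V=\Sigma\cup\{\mathrm{BoS},\$\}$ with model dimension $m=h\,m'$ ($h$ heads of dimension $m'$) and feedforward width $w$ consists of an embedding $V\to\mathbb Q^m$ (no positional encoding), $s$ initial, $r$ repeated and $t$ final layers, an unembedding matrix in $\mathbb Q^{V\times m}$, and a token of $V$ designated ``accept''; all parameters are rational and do not depend on the input. Unrolled $d$ times, it applies the initial layers, then $d$ times the block of repeated layers, then the final layers, to the residual stream $h_i\in\mathbb R^m$ that is initialized with the embeddings of the input tokens. A layer is a self-attention sublayer followed by a feedforward sublayer; each sublayer replaces $h_i$ by $h_i+\delta_i$, where $\delta_i$ is computed from the masked pre-norm values $z_i=\mathrm{layer\_norm}(\mu\odot h_i)$ with a mask $\mu\in\mathbb Q^m$ belonging to the sublayer; layer-norm is either standard layer-norm or RMS norm (without learned gain or bias, and sending a vector of zero deviation, respectively zero norm, to $0$). A feedforward sublayer has $\delta_i=U\,\mathrm{ReLU}(Wz_i)$ with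 $W\in\mathbb Q^{w\times m}$, $U\in\mathbb Q^{m\times w}$. A self-attention sublayer has $\delta_i=W\,\mathrm{concat}(a_{i,1},\dots,a_{i,h})$ with $W\in\mathbb Q^{m\times m}$, where, for $Q^k,K^k,V^k\in\mathbb Q^{m'\times m}$, the vector $a_{i,k}$ is the uniform average of $V^kz_j$ over those $j\le i$ that maximize $(Q^kz_i)^\top K^kz_j$ among all $j\le i$ (causally masked, averaging-hard attention). The logits are the unembedding matrix applied to the residual stream at the last position, and the output is the token whose logit is strictly larger than all others. \emph{Precision.} A datatype assigns to every $p\in\mathbb N$ and every string in $\{0,1\}^p$ a real number; rounding to precision $p$ means taking the closest such number, ties being broken upwards. The datatype is \emph{accurate} if for some $\varepsilon>0$ and all large $p$, the number $0$ is representable and every real $x$ with $|x|\le 2^{\varepsilon p}$ is within $2^{-\varepsilon p}$ of a representable number (as for fixed-point and floating-point formats). With precision $p$, all parameters are rounded, and every operation (addition, multiplication, division, ReLU, layer-norm, each sum over positions in an attention head) returns the rounding of the exact result on its already rounded arguments. A transformer \emph{recognizes} $L\subseteq\Sigma^*$ with log precision when unrolled to depth $d(\cdot)$ if for every accurate datatype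 there is $c>0$ such that, for every $x\in\Sigma^*$ and every $p\ge c\log_2(|x|+2)$, on the input $\mathrm{BoS}\,x\,\$$, unrolled $d(|x|)$ times and run with precision $p$, it outputs ``accept'' if $x\in L$ and outputs a token other than ``accept'' if $x\notin L$. \emph{Claim.} For each of the two choices of layer-norm the following holds. (a) There are functions $m_{\mathrm{NFA}},w_{\mathrm{NFA}}:\mathbb N\to\mathbb N$ with $m_{\mathrm{NFA}}(q)=O(q^2)$ and $w_{\mathrm{NFA}}(q)=O\big(2^{q^4}\big)$ as $q\to\infty$ such that, for every finite alphabet $\Sigma$ and every language $L\subseteq\Sigma^*$ recognized by a nondeterministic finite automaton with finite state set $Q$, there is a causally masked $(0,8,9)$-universal transformer of model dimension $m_{\mathrm{NFA}}(|Q|)$ and feedforward width $w_{\mathrm{NFA}}(|Q|)$ that recognizes $L$ with log precision when unrolled to depth $d(n)=\lceil\log_2 n\rceil$ (with $d(0)=0$), where $n=|x|$ is the length of the input string $x$ without $\mathrm{BoS}$ and $\$$. (b) There are functions $m_{\mathrm{DFA}},w_{\mathrm{DFA}}:\mathbb N\to\mathbb N$ with $m_{\mathrm{DFA}}(q)=O(q\log_2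 q)$ and $w_{\mathrm{DFA}}(q)=O\big(2^{q^2\log_2^2 q}\big)$ as $q\to\infty$ such that the same holds, with model dimension $m_{\mathrm{DFA}}(|Q|)$ and feedforward width $w_{\mathrm{DFA}}(|Q|)$, for every language recognized by a deterministic finite automaton with finite state set $Q$. -/

import Mathlib

open Filter Asymptotics

universe u v

noncomputable section

namespace LogDepth

/-! ### Numerical datatypes -/

/-- A datatype assigns, for every precision `p`, a real value to every bit string of length `p`. -/
structure Datatype where
  val : (p : ℕ) → (Fin p → Bool) → ℝ

/-- Rounding into the `p`-bit datatype: the representable value closest to `x`, ties being broken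
in favour of the higher value. (The set below is finite and nonempty, so the supremum is its
maximum.) -/
def Datatype.round (D : Datatype) (p : ℕ) (x : ℝ) : ℝ :=
  sSup {y : ℝ | y ∈ Set.range (D.val p) ∧ ∀ z ∈ Set.range (D.val p), |x - y| ≤ |x - z|}

/-- The datatype really delivers a number of correct bits proportional to `p`: for large `p`,
zero is representable, and all reals of magnitude at most `2 ^ (ε p)` are representable up to an
error `2 ^ (-ε p)`. Fixed-point and floating-point formats are of this kind. -/
def Datatype.Accurate (D : Datatype) : Prop :=
  ∃ ε : ℝ, 0 < ε ∧ ∀ᶠ p : ℕ in atTop,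
    (0 : ℝ) ∈ Set.range (D.val p) ∧
    ∀ x : ℝ, |x| ≤ (2 : ℝ) ^ (ε * (p : ℝ)) →
      ∃ y ∈ Set.range (D.val p), |x - y| ≤ (2 : ℝ) ^ (-(ε * (p : ℝ)))

/-! ### Arithmetic with rounding

Throughout, `rd : ℝ → ℝ` is a rounding function. Parameters are rounded before use, and each
operation is the exact operation on its (already rounded) arguments followed by one rounding. -/

/-- Matrix-vector product with rounded entries, rounded products and rounded binary additions,
performed from left to right. -/
def mulVecRd (rd : ℝ → ℝ) {ι : Type*} {k : ℕ} (A : Matrix ι (Fin k) ℚ) (x : Fin k → ℝ) (i : ι) :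
    ℝ :=
  (List.ofFn fun j => rd (rd (A i j : ℝ) * x j)).foldl (fun a b => rd (a + b)) (rd 0)

/-- Dot product with rounded products and rounded binary additions, from left to right. -/
def dotRd (rd : ℝ → ℝ) {k : ℕ} (x y : Fin k → ℝ) : ℝ :=
  (List.ofFn fun j => rd (x j * y j)).foldl (fun a b => rd (a + b)) (rd 0)

/-- The two usual choices for layer normalization. -/
inductive NormKind
  | standard
  | rms

/-- Exact layer normalization on `ℝ ^ m`. A vector whose (root mean square or standard) deviation
is zero is sent to zero. -/
def layerNorm : NormKind → {m : ℕ} → (Fin m → ℝ) → Fin m → ℝ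
  | .standard, m, x => fun i =>
      (x i - (∑ j, x j) / m) / Real.sqrt ((∑ k, (x k - (∑ j, x j) / m) ^ 2) / m)
  | .rms, m, x => fun i => x i / Real.sqrt ((∑ k, x k ^ 2) / m)

/-- Masked pre-norm: layer-norm (one operation) of the entrywise product with the mask. -/
def maskedNorm (norm : NormKind) (rd : ℝ → ℝ) {m : ℕ} (mask : Fin m → ℚ) (x : Fin m → ℝ) :
    Fin m → ℝ :=
  fun i => rd (layerNorm norm (fun j => rd (rd (mask j : ℝ) * x j)) i)

/-! ### Sublayers

A residual stream over `n` positions is a function `Fin n → Fin m → ℝ`. -/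

/-- A self-attention sublayer with `h` heads of dimension `dh`. -/
structure Attention (m h dh : ℕ) where
  mask : Fin m → ℚ
  query : Fin h → Matrix (Fin dh) (Fin m) ℚ
  key : Fin h → Matrix (Fin dh) (Fin m) ℚ
  value : Fin h → Matrix (Fin dh) (Fin m) ℚ
  out : Matrix (Fin m) (Fin (h * dh)) ℚ

/-- A feedforward sublayer of width `w`. -/
structure Feedforward (m w : ℕ) where
  mask : Fin m → ℚ
  inner : Matrix (Fin w) (Fin m) ℚ
  outer : Matrix (Fin m) (Fin w) ℚ

open Classical in
/-- Causally masked averaging-hard attention from position `i`, given the scores `score j` and the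
values `val j`: positions `j ≤ i` of maximal score have unnormalized weight `1`, the others `0`;
the weights are divided by their sum, and the values are averaged with these weights. The two
summations over positions are single operations. -/
def hardAttention (rd : ℝ → ℝ) {n : ℕ} (score val : Fin n → ℝ) (i : Fin n) : ℝ :=
  let e : Fin n → ℝ := fun j => rd (if ∀ k ≤ i, score k ≤ score j then 1 else 0)
  let Z : ℝ := rd (∑ j ∈ Finset.Iic i, e j)
  rd (∑ j ∈ Finset.Iic i, rd (rd (e j / Z) * val j))

/-- One self-attention sublayer, including the residual connection. -/
def Attention.apply {m h dh : ℕ} (A : Attention m h dh) (norm : NormKind) (rd : ℝ → ℝ) {n : ℕ}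
    (x : Fin n → Fin m → ℝ) : Fin n → Fin m → ℝ :=
  let z : Fin n → Fin m → ℝ := fun i => maskedNorm norm rd A.mask (x i)
  let q : Fin h → Fin n → Fin dh → ℝ := fun k i => mulVecRd rd (A.query k) (z i)
  let key : Fin h → Fin n → Fin dh → ℝ := fun k i => mulVecRd rd (A.key k) (z i)
  let val : Fin h → Fin n → Fin dh → ℝ := fun k i => mulVecRd rd (A.value k) (z i)
  let head : Fin n → Fin h → Fin dh → ℝ := fun i k l =>
    hardAttention rd (fun j => dotRd rd (q k i) (key k j)) (fun j => val k j l) i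
  let concat : Fin n → Fin (h * dh) → ℝ := fun i a =>
    head i (finProdFinEquiv.symm a).1 (finProdFinEquiv.symm a).2
  fun i a => rd (x i a + mulVecRd rd A.out (concat i) a)

/-- One feedforward sublayer, including the residual connection. -/
def Feedforward.apply {m w : ℕ} (F : Feedforward m w) (norm : NormKind) (rd : ℝ → ℝ) {n : ℕ}
    (x : Fin n → Fin m → ℝ) : Fin n → Fin m → ℝ :=
  fun i a =>
    let z : Fin m → ℝ := maskedNorm norm rd F.mask (x i)
    let hidden : Fin w → ℝ := fun b => rd (max 0 (mulVecRd rd F.inner z b))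
    rd (x i a + mulVecRd rd F.outer hidden a)

/-- A transformer layer: a self-attention sublayer followed by a feedforward sublayer. -/
structure Layer (m h dh w : ℕ) where
  attn : Attention m h dh
  ff : Feedforward m w

def Layer.apply {m h dh w : ℕ} (Λ : Layer m h dh w) (norm : NormKind) (rd : ℝ → ℝ) {n : ℕ}
    (x : Fin n → Fin m → ℝ) : Fin n → Fin m → ℝ :=
  Λ.ff.apply norm rd (Λ.attn.apply norm rd x)

/-! ### Universal transformers -/

/-- A decoder-only, causally masked `(s, r, t)`-universal transformer over the vocabulary `V`, of
model dimension `m` and feedforward width `w`, without positional encodings. All parameters are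
rational and do not depend on the input. One vocabulary item is identified with "accept". -/
structure UniversalTransformer (V : Type*) (s r t m w : ℕ) where
  heads : ℕ
  headDim : ℕ
  dim_eq : heads * headDim = m
  embed : V → Fin m → ℚ
  initial : Fin s → Layer m heads headDim w
  repeated : Fin r → Layer m heads headDim w
  final : Fin t → Layer m heads headDim w
  unembed : Matrix V (Fin m) ℚ
  accept : V

namespace UniversalTransformer

variable {V : Type*} {s r t m w : ℕ}

/-- The list of layers that are executed, in order, when the transformer is unrolled `d` times. -/
def layers (T : UniversalTransformer V s r t m w) (d : ℕ) :
    List (Layer m T.heads T.headDim w) :=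
  List.ofFn T.initial ++ (List.replicate d (List.ofFn T.repeated)).flatten ++ List.ofFn T.final

/-- The residual stream after all layers, on the input tokens `x`. -/
def residual (T : UniversalTransformer V s r t m w) (norm : NormKind) (rd : ℝ → ℝ) (d : ℕ) {n : ℕ}
    (x : Fin n → V) : Fin n → Fin m → ℝ :=
  (T.layers d).foldl (fun h Λ => Λ.apply norm rd h) (fun i a => rd (T.embed (x i) a : ℝ))

/-- The logits, read off at the last position. -/
def logits (T : UniversalTransformer V s r t m w) (norm : NormKind) (rd : ℝ → ℝ) (d : ℕ) {n : ℕ}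
    (x : Fin (n + 1) → V) : V → ℝ :=
  mulVecRd rd T.unembed (T.residual norm rd d x (Fin.last n))

/-- `v` is the output token: it is the one with the (strictly) maximal logit. -/
def Outputs (T : UniversalTransformer V s r t m w) (norm : NormKind) (rd : ℝ → ℝ) (d : ℕ) {n : ℕ}
    (x : Fin (n + 1) → V) (v : V) : Prop :=
  ∀ u, u ≠ v → T.logits norm rd d x u < T.logits norm rd d x v

end UniversalTransformer

/-- The vocabulary: the letters, a beginning-of-sequence symbol, and the end symbol `$`. -/
inductive Token (α : Type u) : Type u
  | bos : Token α
  | letter : α → Token α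
  | eos : Token α

/-- The input `w $`, preceded by the beginning-of-sequence symbol. -/
def prompt {α : Type u} (w : List α) : Fin (w.length + 1 + 1) → Token α :=
  Fin.cons (α := fun _ => Token α) Token.bos
    (Fin.snoc (α := fun _ => Token α) (fun i : Fin w.length => Token.letter (w.get i)) Token.eos)

/-- The log-precision transformer `T`, unrolled `d |w|` times on input `w $`, recognizes whether
`w ∈ L`: for every accurate datatype there is a constant `c` such that, on every `w`, and with any
precision of at least `c * log₂ N` bits, where `N = |w| + 2` is the number of input tokens, the
output token is "accept" if `w ∈ L`, and another token if `w ∉ L`. -/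
def UniversalTransformer.Recognizes {α : Type u} {s r t m w : ℕ}
    (T : UniversalTransformer (Token α) s r t m w) (norm : NormKind) (d : ℕ → ℕ)
    (L : Language α) : Prop :=
  ∀ D : Datatype, D.Accurate → ∃ c : ℝ, 0 < c ∧
    ∀ (x : List α) (p : ℕ), c * Real.logb 2 ((x.length : ℝ) + 2) ≤ (p : ℝ) →
      (x ∈ L → T.Outputs norm (D.round p) (d x.length) (prompt x) T.accept) ∧
      (x ∉ L → ∃ v, v ≠ T.accept ∧ T.Outputs norm (D.round p) (d x.length) (prompt x) v)

/-- The depth function `⌈log₂ n⌉` (with value `0` at `n = 0`). -/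
def logDepth (n : ℕ) : ℕ := ⌈Real.logb 2 (n : ℝ)⌉₊

end LogDepth

end

/-! Membership is read off from composable bit vectors: a map φ from words to B bits with φ(uv) = op
(φ u) (φ v), and a test F of φ(x). For an NFA with q states, φ is the Boolean reachability matrix (B
= q²); for a DFA it is the table of the transition function with states coded in binary (B = q(⌊log₂
q⌋ + 1)). `exists_recognizer` treats every such φ.

The algorithm is doubling. Before round j, position p holds φ of the window of 2^j letters ending at
p. In the round it attends to position p - 2^j (clamped at `BoS`), fetches the bits and the pointer
stored there, and composes the bits by a lookup table with 2^B · 2^B hidden units. The fetched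
pointer is the pointer for the next round (`round_tracks`).

Positions come from uniform attention: averaging the marker of `BoS` yields 1/(p+1), and layer-norm
turns (1/(p+1), 1) into the unit vector in direction (1, p+1). Keys and pointers are such vectors,
and the right key wins by a margin of at least 1/(8N⁴) (`dot_dir_gap`). Layer-norm is otherwise
tamed in three ways. Each coordinate is stored with its negation, so means vanish and both kinds of
norm agree. The number of logical coordinates is a perfect square k², so scale factors are rational.
In the retrieval and lookup sublayers the masked vector has squared length exactly k², so that
normalization leaves it unchanged.

For precision, `Tracks` says that a rounded computation follows the exact one with the error
enlarged by a constant independent of word and round. After ⌈log₂ n⌉ rounds the growth is polynomial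
in n, and c log n bits make the initial error small enough for the margins N⁻⁴ and for the logits
(`exists_precision`, `transformer_recognizes`). -/

noncomputable section

namespace LogDepth

/-! ### Approximation up to a constant multiple of the current error -/

/-- A rounding function together with the input length `N` and an error bound `e`. -/
structure Ctx where
  rd : ℝ → ℝ
  N : ℕ
  e : ℝ

/-- Rounding is accurate to `e / N` on numbers up to `C N`, and `e` is small compared with
`N ^ (-4)`. -/
structure Ctx.Good (c : Ctx) (C : ℝ) : Prop where
  rd_zero : c.rd 0 = 0
  e_pos : 0 < c.e
  one_le : 1 ≤ c.N
  small : C * (c.N : ℝ) ^ 4 * c.e ≤ 1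
  close : ∀ y, |y| ≤ C * c.N → c.N * |c.rd y - y| ≤ c.e

namespace Ctx.Good

variable {c : Ctx} {C C' : ℝ}

lemma one_le_cast (h : c.Good C) : (1 : ℝ) ≤ c.N := by exact_mod_cast h.one_le

lemma mono (h : c.Good C') (hC : C ≤ C') : c.Good C := by
  have h1 := h.one_le_cast
  refine ⟨h.rd_zero, h.e_pos, h.one_le, le_trans ?_ h.small, fun y hy => h.close y (hy.trans ?_)⟩
  · have := h.e_pos
    gcongr
  · gcongr

/-- Lets a computation continue from the enlarged error `C * c.e`, so that the constants of
successive sublayers multiply. -/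
lemma scale (h : c.Good (C * C')) (hC : 1 ≤ C) (hC' : 0 ≤ C') :
    Ctx.Good ⟨c.rd, c.N, C * c.e⟩ C' := by
  have h1 := h.one_le_cast
  have h0 := h.e_pos
  refine ⟨h.rd_zero, by positivity, h.one_le, ?_, fun y hy => (h.close y (hy.trans ?_)).trans ?_⟩
  · have := h.small
    dsimp only
    linarith
  · dsimp only
    gcongr
    nlinarith
  · dsimp only
    nlinarith

lemma e_le (h : c.Good C) (hC : 0 ≤ C) : C * c.e ≤ 1 := by
  have h1 := h.one_le_cast
  have h0 := h.e_pos
  refine le_trans ?_ h.small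
  have : (1 : ℝ) ≤ (c.N : ℝ) ^ 4 := one_le_pow₀ h1
  nlinarith [mul_nonneg hC h0.le]

lemma rd_close (h : c.Good C) (hC : 0 ≤ C) {y : ℝ} (hy : |y| ≤ C) : |c.rd y - y| ≤ c.e := by
  have h1 := h.one_le_cast
  refine le_trans ?_ (h.close y (hy.trans (by nlinarith)))
  nlinarith [abs_nonneg (c.rd y - y)]

end Ctx.Good

/-- The computed quantity `act` is within a constant multiple of the error bound from `ideal`. -/
def Approx {T : Type*} (c : T → Ctx) (act ideal : T → ℝ) : Prop :=
  ∃ C, 1 ≤ C ∧ ∀ t, (c t).Good C → |act t - ideal t| ≤ C * (c t).e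

/-- The bound is uniform over all instances, which keeps the constants in `Approx` independent of
the input length. -/
def Bdd {T : Type*} (f : T → ℝ) : Prop := ∃ B, 0 ≤ B ∧ ∀ t, |f t| ≤ B

/-! ### Closure of approximate computation under arithmetic with rounding -/

section Closure

variable {T T' : Type*} {c : T → Ctx} {a a' b b' f g : T → ℝ}

lemma Bdd.of_le (B : ℝ) (h : ∀ t, |f t| ≤ B) : Bdd f :=
  ⟨max B 0, le_max_right _ _, fun t => (h t).trans (le_max_left _ _)⟩

lemma Bdd.const (r : ℝ) : Bdd (fun _ : T => r) := Bdd.of_le |r| fun _ => le_rfl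

lemma Bdd.comp (h : Bdd f) (φ : T' → T) : Bdd (f ∘ φ) :=
  let ⟨B, h0, hB⟩ := h
  ⟨B, h0, fun t => hB (φ t)⟩

lemma Bdd.add (hf : Bdd f) (hg : Bdd g) : Bdd (fun t => f t + g t) := by
  obtain ⟨B, h0, hB⟩ := hf
  obtain ⟨B', h0', hB'⟩ := hg
  exact ⟨B + B', by positivity, fun t => (abs_add_le _ _).trans (add_le_add (hB t) (hB' t))⟩

lemma Bdd.mul (hf : Bdd f) (hg : Bdd g) : Bdd (fun t => f t * g t) := by
  obtain ⟨B, h0, hB⟩ := hf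
  obtain ⟨B', h0', hB'⟩ := hg
  exact ⟨B * B', by positivity, fun t => by rw [abs_mul]; gcongr; exacts [hB t, hB' t]⟩

lemma Bdd.max_zero (hf : Bdd f) : Bdd (fun t => max 0 (f t)) := by
  obtain ⟨B, h0, hB⟩ := hf
  refine ⟨B, h0, fun t => ?_⟩
  rw [abs_of_nonneg (le_max_left _ _)]
  exact max_le h0 ((le_abs_self _).trans (hB t))

lemma Bdd.sum {ι : Type*} (s : Finset ι) {f : ι → T → ℝ} (h : ∀ i, Bdd (f i)) :
    Bdd (fun t => ∑ i ∈ s, f i t) := by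
  choose B h0 hB using h
  exact ⟨∑ i ∈ s, B i, Finset.sum_nonneg fun i _ => h0 i, fun t =>
    (Finset.abs_sum_le_sum_abs _ _).trans (Finset.sum_le_sum fun i _ => hB i t)⟩

lemma Approx.refl (f : T → ℝ) : Approx c f f :=
  ⟨1, le_rfl, fun t h => by simpa using h.e_pos.le⟩

lemma Approx.comp (h : Approx c a a') (φ : T' → T) : Approx (c ∘ φ) (a ∘ φ) (a' ∘ φ) :=
  let ⟨C, h1, hC⟩ := h
  ⟨C, h1, fun t => hC (φ t)⟩

lemma Approx.add (ha : Approx c a a') (hb : Approx c b b') :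
    Approx c (fun t => a t + b t) (fun t => a' t + b' t) := by
  obtain ⟨C, h1, hC⟩ := ha
  obtain ⟨D, h1', hD⟩ := hb
  refine ⟨C + D, by linarith, fun t h => ?_⟩
  have e1 := hC t (h.mono (by linarith))
  have e2 := hD t (h.mono (by linarith))
  calc |a t + b t - (a' t + b' t)| = |(a t - a' t) + (b t - b' t)| := by ring_nf
    _ ≤ |a t - a' t| + |b t - b' t| := abs_add_le _ _
    _ ≤ (C + D) * (c t).e := by linarith

lemma Approx.bound (ha : Approx c a a') (hb : Bdd a') :
    ∃ C, 1 ≤ C ∧ ∀ t, (c t).Good C → |a t| ≤ C := by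
  obtain ⟨C, h1, hC⟩ := ha
  obtain ⟨B, h0, hB⟩ := hb
  refine ⟨C + B + 1, by linarith, fun t h => ?_⟩
  have e1 := hC t (h.mono (by linarith))
  have e2 : C * (c t).e ≤ 1 := (h.mono (by linarith : C ≤ C + B + 1)).e_le (by linarith)
  have e3 := abs_sub_abs_le_abs_sub (a t) (a' t)
  linarith [hB t]

lemma Approx.mul (ha : Approx c a a') (hb : Approx c b b') (ba : Bdd a') (bb : Bdd b') :
    Approx c (fun t => a t * b t) (fun t => a' t * b' t) := by
  obtain ⟨C', h1', hC'⟩ := ha.bound ba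
  obtain ⟨C, h1, hC⟩ := ha
  obtain ⟨D, h2, hD⟩ := hb
  obtain ⟨B, h0, hB⟩ := bb
  -- The first two summands estimate the product; the others make the constant exceed `C`, `D` and
  -- `C'`, so that `Good` can be weakened to each.
  refine ⟨C' * D + C * B + C + D + C', by nlinarith [mul_nonneg (by linarith : 0 ≤ C) h0], fun t h => ?_⟩
  have p1 : 0 ≤ C' * D := by nlinarith
  have p2 : 0 ≤ C * B := by nlinarith
  have e1 := hC t (h.mono (by linarith))
  have e2 := hD t (h.mono (by linarith))
  have e3 := hC' t (h.mono (by linarith))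
  have e0 := h.e_pos
  have := hB t
  calc |a t * b t - a' t * b' t| = |a t * (b t - b' t) + (a t - a' t) * b' t| := by ring_nf
    _ ≤ |a t * (b t - b' t)| + |(a t - a' t) * b' t| := abs_add_le _ _
    _ ≤ C' * (D * (c t).e) + C * (c t).e * B := by
        rw [abs_mul, abs_mul]; gcongr
    _ ≤ _ := by nlinarith

lemma Approx.max_zero (ha : Approx c a a') :
    Approx c (fun t => max 0 (a t)) (fun t => max 0 (a' t)) := by
  obtain ⟨C, h1, hC⟩ := ha
  refine ⟨C, h1, fun t h => (le_trans ?_ (hC t h))⟩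
  have := abs_max_sub_max_le_max 0 (a t) 0 (a' t)
  simpa using this

lemma Approx.rd (ha : Approx c a a') (hb : Bdd a') :
    Approx c (fun t => (c t).rd (a t)) a' := by
  obtain ⟨C', h1', hC'⟩ := ha.bound hb
  obtain ⟨C, h1, hC⟩ := ha
  refine ⟨C + C' + 1, by linarith, fun t h => ?_⟩
  have e1 := hC t (h.mono (by linarith))
  have e2 := (h.mono (by linarith : C' ≤ C + C' + 1)).rd_close (by linarith)
    (hC' t (h.mono (by linarith)))
  have e0 := h.e_pos
  have := abs_sub_le ((c t).rd (a t)) (a t) (a' t)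
  nlinarith

lemma Approx.sum {ι : Type*} (s : Finset ι) {a a' : ι → T → ℝ} (h : ∀ i, Approx c (a i) (a' i)) :
    Approx c (fun t => ∑ i ∈ s, a i t) (fun t => ∑ i ∈ s, a' i t) := by
  classical
  induction s using Finset.induction_on with
  | empty => simpa using Approx.refl _
  | insert i s hi ih =>
    simp only [Finset.sum_insert hi]
    exact (h i).add ih

lemma Approx.congr (ha : Approx c a a') (h : ∀ t, a' t = b' t) : Approx c a b' := by
  rwa [← funext h]

lemma Approx.foldl {k : ℕ} {a a' : Fin k → T → ℝ} (h : ∀ j, Approx c (a j) (a' j))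
    (hb : ∀ j, Bdd (a' j)) :
    Approx c (fun t => (List.ofFn fun j => a j t).foldl (fun x y => (c t).rd (x + y)) ((c t).rd 0))
      (fun t => ∑ j, a' j t) := by
  induction k with
  | zero => simpa using (Approx.refl (c := c) (fun _ => 0)).rd (Bdd.const 0)
  | succ k ih =>
    simp only [List.ofFn_succ_last, List.foldl_append, List.foldl_cons, List.foldl_nil,
      Fin.sum_univ_castSucc]
    exact ((ih (fun j => h j.castSucc) (fun j => hb _)).add (h _)).rd
      ((Bdd.sum _ fun j => hb _).add (hb _))

lemma Approx.mulVecRd {ι : Type*} {k : ℕ} (A : Matrix ι (Fin k) ℚ) {z Z : T → Fin k → ℝ}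
    (h : ∀ j, Approx c (fun t => z t j) (fun t => Z t j)) (hb : ∀ j, Bdd (fun t => Z t j)) (i : ι) :
    Approx c (fun t => mulVecRd (c t).rd A (z t) i) (fun t => ∑ j, (A i j : ℝ) * Z t j) := by
  refine Approx.foldl (a := fun _ _ => _) (a' := fun j t => (A i j : ℝ) * Z t j) (fun j => ?_)
    (fun j => (Bdd.const _).mul (hb j))
  exact ((((Approx.refl _).rd (Bdd.const _)).mul (h j) (Bdd.const _) (hb j)).rd
    ((Bdd.const _).mul (hb j)))

lemma Approx.dotRd {k : ℕ} {x X y Y : T → Fin k → ℝ}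
    (hx : ∀ j, Approx c (fun t => x t j) (fun t => X t j)) (bx : ∀ j, Bdd (fun t => X t j))
    (hy : ∀ j, Approx c (fun t => y t j) (fun t => Y t j)) (bY : ∀ j, Bdd (fun t => Y t j)) :
    Approx c (fun t => dotRd (c t).rd (x t) (y t)) (fun t => ∑ j, X t j * Y t j) :=
  Approx.foldl (a := fun _ _ => _) (a' := fun j t => X t j * Y t j)
    (fun j => ((hx j).mul (hy j) (bx j) (bY j)).rd ((bx j).mul (bY j)))
    (fun j => (bx j).mul (bY j))

/-- The square root is Lipschitz away from zero: once the error of the radicand is at most `c₀ / 2`,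
both radicands are at least `c₀ / 2`. -/
lemma Approx.div_sqrt {n d N D : T → ℝ} (hn : Approx c n N) (hd : Approx c d D)
    (bN : Bdd N) {c₀ : ℝ} (h0 : 0 < c₀) (hD : ∀ t, c₀ ≤ D t) :
    Approx c (fun t => n t / √(d t)) (fun t => N t / √(D t)) := by
  obtain ⟨C, h1, hC⟩ := hn
  obtain ⟨C', h1', hC'⟩ := hd
  obtain ⟨B, hB0, hB⟩ := bN
  set s := √(c₀ / 2) with hs
  have s0 : 0 < s := Real.sqrt_pos.2 (by linarith)
  -- The first two summands bound the error; `2 * C' / c₀` forces the error of the radicand below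
  -- `c₀ / 2`.
  refine ⟨C / s + B * C' / s ^ 3 + 2 * C' / c₀ + C + C', ?_, fun t h => ?_⟩
  · have : 0 ≤ C / s + B * C' / s ^ 3 + 2 * C' / c₀ := by positivity
    linarith
  have q1 : 0 ≤ C / s := by positivity
  have q2 : 0 ≤ B * C' / s ^ 3 := by positivity
  have q3 : 0 ≤ 2 * C' / c₀ := by positivity
  have e0 := h.e_pos
  have e1 := hC t (h.mono (by linarith))
  have e2 := hC' t (h.mono (by linarith))
  have e3 : 2 * C' / c₀ * (c t).e ≤ 1 :=
    (h.mono (by linarith : 2 * C' / c₀ ≤ _)).e_le q3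
  have e4 : C' * (c t).e ≤ c₀ / 2 := by
    rw [div_mul_eq_mul_div, div_le_one h0] at e3
    linarith
  have hDt := hD t
  have hdt : c₀ / 2 ≤ d t := by
    have := (abs_le.1 (e2.trans e4)).1
    linarith
  have sd : s ≤ √(d t) := Real.sqrt_le_sqrt hdt
  have sD : s ≤ √(D t) := Real.sqrt_le_sqrt (by linarith)
  have hdiff : |√(D t) - √(d t)| ≤ C' * (c t).e / s := by
    rw [le_div_iff₀ s0]
    calc |√(D t) - √(d t)| * s ≤ |√(D t) - √(d t)| * (√(D t) + √(d t)) := by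
          gcongr; linarith [Real.sqrt_nonneg (d t)]
      _ = |(√(D t) - √(d t)) * (√(D t) + √(d t))| := by
          rw [abs_mul, abs_of_nonneg (by positivity : 0 ≤ √(D t) + √(d t))]
      _ = |D t - d t| := by
          congr 1
          have a1 := Real.sq_sqrt (by linarith : 0 ≤ D t)
          have a2 := Real.sq_sqrt (by linarith : 0 ≤ d t)
          linear_combination a1 - a2
      _ ≤ C' * (c t).e := by rwa [abs_sub_comm]
  have key : n t / √(d t) - N t / √(D t)
      = (n t - N t) / √(d t) + N t * (√(D t) - √(d t)) / (√(d t) * √(D t)) := by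
    have : √(d t) ≠ 0 := by linarith
    have : √(D t) ≠ 0 := by linarith
    field_simp
    ring
  rw [key]
  refine (abs_add_le _ _).trans ?_
  have t1 : |(n t - N t) / √(d t)| ≤ C * (c t).e / s := by
    rw [abs_div, abs_of_nonneg (Real.sqrt_nonneg _)]
    gcongr
  have t2 : |N t * (√(D t) - √(d t)) / (√(d t) * √(D t))| ≤ B * (C' * (c t).e / s) / (s * s) := by
    rw [abs_div, abs_mul, abs_mul, abs_of_nonneg (Real.sqrt_nonneg (d t)),
      abs_of_nonneg (Real.sqrt_nonneg (D t))]
    gcongr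
    exact hB t
  have t3 : B * (C' * (c t).e / s) / (s * s) = B * C' / s ^ 3 * (c t).e := by
    field_simp
  have t4 : C * (c t).e / s = C / s * (c t).e := by ring
  nlinarith [mul_nonneg q3 e0.le]

end Closure

/-! ### Layer-norm -/

/-- The root mean square normalization of the masked vector. -/
def normalized {m : ℕ} (mask : Fin m → ℚ) (h : Fin m → ℝ) (a : Fin m) : ℝ :=
  mask a * h a / √((∑ b, (mask b * h b) ^ 2) / m)

section Norm

variable {T : Type*} {c : T → Ctx} {m : ℕ}

lemma Approx.rms {w V : T → Fin m → ℝ} (h : ∀ a, Approx c (fun t => w t a) (fun t => V t a))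
    (hb : ∀ a, Bdd (fun t => V t a)) {c₀ : ℝ} (h0 : 0 < c₀)
    (hV : ∀ t, c₀ ≤ (∑ b, V t b ^ 2) / m) (a : Fin m) :
    Approx c (fun t => w t a / √((∑ b, w t b ^ 2) / m))
      (fun t => V t a / √((∑ b, V t b ^ 2) / m)) := by
  refine Approx.div_sqrt (h a) ?_ (hb a) h0 hV
  simp only [div_eq_mul_inv, pow_two]
  exact (Approx.sum _ fun b => (h b).mul (h b) (hb b) (hb b)).mul (Approx.refl _)
    (Bdd.sum _ fun b => (hb b).mul (hb b)) (Bdd.const _)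

lemma normalized_bdd (mask : Fin m → ℚ) (H : T → Fin m → ℝ) (a : Fin m) :
    Bdd (fun t => normalized mask (H t) a) := by
  refine Bdd.of_le (√m) fun t => ?_
  unfold normalized
  set S := ∑ b, ((mask b : ℝ) * H t b) ^ 2
  have hm : (0 : ℝ) < m := by exact_mod_cast a.pos
  have hS : ((mask a : ℝ) * H t a) ^ 2 ≤ S :=
    Finset.single_le_sum (f := fun b => ((mask b : ℝ) * H t b) ^ 2) (fun b _ => sq_nonneg _)
      (Finset.mem_univ a)
  rw [abs_div, abs_of_nonneg (Real.sqrt_nonneg _)]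
  refine div_le_of_le_mul₀ (Real.sqrt_nonneg _) (Real.sqrt_nonneg _) ?_
  rw [← Real.sqrt_mul hm.le, mul_div_cancel₀ _ hm.ne']
  exact Real.abs_le_sqrt hS

/-- Since the ideal masked vector has mean zero, standard and RMS norm have the same ideal value;
the computed mean is only an error term. -/
lemma Approx.maskedNorm (norm : NormKind) (mask : Fin m → ℚ) {x H : T → Fin m → ℝ}
    (h : ∀ a, Approx c (fun t => x t a) (fun t => H t a)) (hb : ∀ a, Bdd (fun t => H t a))
    (hmean : ∀ t, ∑ b, (mask b : ℝ) * H t b = 0) {c₀ : ℝ} (h0 : 0 < c₀)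
    (hV : ∀ t, c₀ ≤ (∑ b, ((mask b : ℝ) * H t b) ^ 2) / m) (a : Fin m) :
    Approx c (fun t => maskedNorm norm (c t).rd mask (x t) a)
      (fun t => normalized mask (H t) a) := by
  have hbV : ∀ b, Bdd (fun t => (mask b : ℝ) * H t b) := fun b => (Bdd.const _).mul (hb b)
  have hw : ∀ b, Approx c (fun t => (c t).rd ((c t).rd (mask b : ℝ) * x t b))
      (fun t => (mask b : ℝ) * H t b) := fun b =>
    (((Approx.refl _).rd (Bdd.const _)).mul (h b) (Bdd.const _) (hb b)).rd (hbV b)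
  refine Approx.rd ?_ (normalized_bdd mask H a)
  cases norm with
  | rms => exact Approx.rms hw hbV h0 hV a
  | standard =>
    refine Approx.rms (w := fun t b => (c t).rd ((c t).rd (mask b : ℝ) * x t b)
      - (∑ j, (c t).rd ((c t).rd (mask j : ℝ) * x t j)) / m) (fun b => ?_) hbV h0 hV a
    have h1 : Approx c (fun t => ∑ j, (c t).rd ((c t).rd (mask j : ℝ) * x t j))
        (fun t => ∑ j, (mask j : ℝ) * H t j) := Approx.sum _ hw
    have h2 := (hw b).add (h1.mul (Approx.refl (fun _ => (-(m : ℝ)⁻¹)))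
      (Bdd.sum _ hbV) (Bdd.const _))
    have h3 : ∀ t, (mask b : ℝ) * H t b + (∑ j, (mask j : ℝ) * H t j) * (-(m : ℝ)⁻¹)
        = (mask b : ℝ) * H t b := fun t => by rw [hmean]; ring
    convert h2.congr h3 using 2 with t
    ring

end Norm

/-! ### Attention heads -/

section Heads

variable {T : Type*} {c : T → Ctx} {n : T → ℕ}

/-- The weight `1 / P` of one of `P` tied positions, computed with rounding. -/
lemma tied_weight_close {r : ℝ → ℝ} {N P e : ℝ} (e0 : 0 ≤ e) (e1 : 20 * e ≤ 1) (hP1 : 1 ≤ P)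
    (hPN : P ≤ N) (hcl : ∀ y, |y| ≤ 20 * N → N * |r y - y| ≤ e) :
    N * |r (r 1 / r (P * r 1)) - 1 / P| ≤ 3 * e := by
  have a1 : N * |r 1 - 1| ≤ e := hcl 1 (by rw [abs_one]; linarith)
  have a1' : |r 1 - 1| ≤ e := le_trans (by nlinarith [abs_nonneg (r 1 - 1)]) a1
  have r1 : 19 / 20 ≤ r 1 ∧ r 1 ≤ 21 / 20 := by
    have := abs_le.1 a1'
    constructor <;> linarith
  have a2 : N * |r (P * r 1) - P * r 1| ≤ e := hcl _ (by
    rw [abs_of_nonneg (by nlinarith)]; nlinarith)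
  set Z := r (P * r 1) with hZ
  have a2' : |Z - P * r 1| ≤ e := le_trans (by nlinarith [abs_nonneg (Z - P * r 1)]) a2
  have hZ1 : P / 2 ≤ Z := by
    have := abs_le.1 a2'
    nlinarith
  have hZ0 : 0 < Z := by linarith
  -- The factor `N` is absorbed by the rounding error of `Z`, and `Z * P ≥ 1 / 2`.
  have a3 : N * |r 1 / Z - 1 / P| ≤ 2 * e := by
    have : r 1 / Z - 1 / P = -(Z - P * r 1) / (Z * P) := by field_simp; ring
    rw [this, abs_div, abs_neg, abs_of_pos (by positivity : 0 < Z * P), ← mul_div_assoc,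
      div_le_iff₀ (by positivity)]
    have : 1 / 2 ≤ Z * P := by nlinarith
    nlinarith
  have a3' : |r 1 / Z - 1 / P| ≤ 2 * e := le_trans (by nlinarith [abs_nonneg (r 1 / Z - 1 / P)]) a3
  have hPinv : 0 < 1 / P ∧ 1 / P ≤ 1 := ⟨by positivity, by rw [div_le_one (by linarith)]; exact hP1⟩
  have a4 : N * |r (r 1 / Z) - r 1 / Z| ≤ e := hcl _ (by
    have := abs_le.1 a3'
    rw [abs_of_nonneg (by apply div_nonneg <;> linarith)]
    nlinarith)
  have := abs_sub_le (r (r 1 / Z)) (r 1 / Z) (1 / P)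
  nlinarith

lemma hardAttention_of_tied (rd : ℝ → ℝ) {n : ℕ} {score val : Fin n → ℝ} (p : Fin n)
    (hs : ∀ j k, score j = score k) :
    hardAttention rd score val p = rd (∑ j ∈ Finset.Iic p,
      rd (rd (rd 1 / rd (((p : ℕ) + 1 : ℝ) * rd 1)) * val j)) := by
  have hone : ∀ j, (∀ k ≤ p, score k ≤ score j) := fun j k _ => (hs k j).le
  have hsum : ∑ _j ∈ Finset.Iic p, rd 1 = ((p : ℕ) + 1 : ℝ) * rd 1 := by simp
  simp [hardAttention, if_pos (hone _)]

/-- Summing P ≤ N terms must not multiply the error by P, so each summand has to be within O(e / P)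
of its ideal value. This is why `Good.close` asks for rounding error `e / N`. -/
lemma Approx.hardAttention_uniform (p : ∀ t, Fin (n t)) (hn : ∀ t, n t ≤ (c t).N)
    {score val V : ∀ t, Fin (n t) → ℝ} (hs : ∀ t, (c t).rd 0 = 0 → ∀ j k, score t j = score t k)
    (h : Approx (T := Σ t, Fin (n t)) (fun s => c s.1) (fun s => val s.1 s.2) (fun s => V s.1 s.2))
    (hb : Bdd (T := Σ t, Fin (n t)) (fun s => V s.1 s.2)) :
    Approx c (fun t => hardAttention (c t).rd (score t) (val t) (p t))
      (fun t => (∑ j ∈ Finset.Iic (p t), V t j) / ((p t : ℕ) + 1)) := by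
  obtain ⟨D, hD1, hD⟩ := h.bound hb
  obtain ⟨C, hC1, hC⟩ := h
  obtain ⟨B, hB0, hB⟩ := hb
  refine ⟨C + 20 * D + 20 + B, by linarith, fun t hg => ?_⟩
  beta_reduce
  rw [hardAttention_of_tied _ _ (hs t hg.rd_zero)]
  have e0 : 0 < (c t).e := hg.e_pos
  have hN1 := hg.one_le_cast
  have e1 : 20 * (c t).e ≤ 1 := (hg.mono (by linarith : (20 : ℝ) ≤ _)).e_le (by norm_num)
  have hcl : ∀ y : ℝ, |y| ≤ 20 * (c t).N → (c t).N * |(c t).rd y - y| ≤ (c t).e :=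
    (hg.mono (by linarith : (20 : ℝ) ≤ _)).close
  have hclD : ∀ y, |y| ≤ (20 * D) * (c t).N → (c t).N * |(c t).rd y - y| ≤ (c t).e :=
    (hg.mono (by linarith : (20 : ℝ) * D ≤ _)).close
  have hcl' := hg.close
  have hPN : ((p t : ℕ) : ℝ) + 1 ≤ (c t).N := by
    have : (p t : ℕ) + 1 ≤ (c t).N := Nat.lt_iff_add_one_le.1 ((p t).2.trans_le (hn t))
    exact_mod_cast this
  have hval : ∀ j, |val t j| ≤ D := fun j => hD ⟨t, j⟩ (hg.mono (by linarith))
  have hvV : ∀ j, |val t j - V t j| ≤ C * (c t).e := fun j => hC ⟨t, j⟩ (hg.mono (by linarith))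
  have hV : ∀ j, |V t j| ≤ B := fun j => hB ⟨t, j⟩
  have hcard : ((Finset.Iic (p t)).card : ℝ) = ((p t : ℕ) : ℝ) + 1 := by simp
  have hP1 : 1 ≤ ((p t : ℕ) : ℝ) + 1 := by simp
  have a5 := tied_weight_close e0.le e1 hP1 hPN hcl
  generalize ((p t : ℕ) : ℝ) + 1 = P at *
  generalize (c t).e = e at *
  generalize ((c t).N : ℝ) = N at *
  generalize (c t).rd = r at *
  generalize r (r 1 / r (P * r 1)) = W at *
  have hP0 : 0 < P := by linarith
  have a5' : |W - 1 / P| ≤ 3 * e := le_trans (by nlinarith [abs_nonneg (W - 1 / P)]) a5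
  have hPinv : 0 < 1 / P ∧ 1 / P ≤ 1 := ⟨by positivity, by rw [div_le_one (by linarith)]; exact hP1⟩
  have hW2 : |W| ≤ 2 := by
    have := abs_le.1 a5'
    rw [abs_le]
    constructor <;> linarith
  have a6 : ∀ j, P * |r (W * val t j) - V t j / P| ≤ (3 * D + C + 1) * e := fun j => by
    have b1 : N * |r (W * val t j) - W * val t j| ≤ e := hclD _ (by
      rw [abs_mul]
      calc |W| * |val t j| ≤ 2 * D := by gcongr; exact hval j
        _ ≤ 20 * D * N := by nlinarith)
    have b2 : N * |(W - 1 / P) * val t j| ≤ 3 * D * e := by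
      rw [abs_mul, ← mul_assoc]
      calc N * |W - 1 / P| * |val t j| ≤ 3 * e * D := by gcongr; exact hval j
        _ = _ := by ring
    have b3 : P * |(val t j - V t j) / P| ≤ C * e := by
      rw [abs_div, abs_of_pos hP0, mul_div_cancel₀ _ hP0.ne']
      exact hvV j
    have b4 : r (W * val t j) - V t j / P = (r (W * val t j) - W * val t j)
        + (W - 1 / P) * val t j + (val t j - V t j) / P := by ring
    have b5 := abs_add_three (r (W * val t j) - W * val t j) ((W - 1 / P) * val t j)
      ((val t j - V t j) / P)
    rw [b4]
    have b1' := mul_le_mul_of_nonneg_right hPN (abs_nonneg (r (W * val t j) - W * val t j))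
    have b2' := mul_le_mul_of_nonneg_right hPN (abs_nonneg ((W - 1 / P) * val t j))
    have b5' := mul_le_mul_of_nonneg_left b5 hP0.le
    linarith
  have a7 : |∑ j ∈ Finset.Iic (p t), r (W * val t j) - (∑ j ∈ Finset.Iic (p t), V t j) / P|
      ≤ (3 * D + C + 1) * e := by
    rw [Finset.sum_div, ← Finset.sum_sub_distrib]
    refine (Finset.abs_sum_le_sum_abs _ _).trans ?_
    calc ∑ j ∈ Finset.Iic (p t), |r (W * val t j) - V t j / P|
        ≤ ∑ j ∈ Finset.Iic (p t), (3 * D + C + 1) * e / P :=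
          Finset.sum_le_sum fun j _ => by
            rw [le_div_iff₀ hP0, mul_comm]; exact a6 j
      _ = (3 * D + C + 1) * e := by
          rw [Finset.sum_const, nsmul_eq_mul, hcard]; field_simp
  have a8 : |(∑ j ∈ Finset.Iic (p t), V t j) / P| ≤ B := by
    rw [abs_div, abs_of_pos hP0, div_le_iff₀ hP0]
    refine (Finset.abs_sum_le_sum_abs _ _).trans ?_
    calc _ ≤ ∑ j ∈ Finset.Iic (p t), B := Finset.sum_le_sum fun j _ => hV j
      _ = B * P := by rw [Finset.sum_const, nsmul_eq_mul, hcard, mul_comm]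
  generalize ∑ j ∈ Finset.Iic (p t), r (W * val t j) = S at *
  generalize (∑ j ∈ Finset.Iic (p t), V t j) / P = S' at *
  have hC0 : C * e ≤ C := by nlinarith
  have hD0 : D * e ≤ D := by nlinarith
  have a9 : |r S - S| ≤ e := by
    refine le_trans ?_ (hcl' S ?_)
    · nlinarith [abs_nonneg (r S - S)]
    · have q1 := abs_sub_abs_le_abs_sub S S'
      have : |S| ≤ C + 20 * D + 20 + B := by linarith
      refine this.trans ?_
      nlinarith
  have := abs_sub_le (r S) S S'
  have : 0 ≤ B * e := by positivity
  have : 0 ≤ D * e := by nlinarith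
  linarith

/-- By `Good.small` the margin exceeds twice the score error, so the maximizer is `sel` despite
rounding. As zero is rounded to zero, all other positions contribute exactly zero and both sums
collapse to one term. -/
lemma Approx.hardAttention_select (p sel : ∀ t, Fin (n t)) (hn : ∀ t, n t ≤ (c t).N)
    {score val V ideal : ∀ t, Fin (n t) → ℝ} {γ : ℝ} (hγ : 0 < γ)
    (hsc : Approx (T := Σ t, Fin (n t)) (fun s => c s.1) (fun s => score s.1 s.2)
      (fun s => ideal s.1 s.2))
    (hsel : ∀ t, sel t ≤ p t)
    (hgap : ∀ t, ∀ j ≤ p t, j ≠ sel t → ideal t j + γ / (n t : ℝ) ^ 4 ≤ ideal t (sel t))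
    (h : Approx (T := Σ t, Fin (n t)) (fun s => c s.1) (fun s => val s.1 s.2) (fun s => V s.1 s.2))
    (hb : Bdd (T := Σ t, Fin (n t)) (fun s => V s.1 s.2)) :
    Approx c (fun t => hardAttention (c t).rd (score t) (val t) (p t))
      (fun t => V t (sel t)) := by
  have hv : Approx c (fun t => val t (sel t)) (fun t => V t (sel t)) :=
    h.comp (fun t => (⟨t, sel t⟩ : Σ t, Fin (n t)))
  have hbv : Bdd (fun t => V t (sel t)) := hb.comp (fun t => (⟨t, sel t⟩ : Σ t, Fin (n t)))
  have h1 : Approx c (fun t => (c t).rd 1) (fun _ => 1) := (Approx.refl _).rd (Bdd.const _)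
  have hZ : Approx c (fun t => (c t).rd ((c t).rd 1)) (fun _ => 1) := h1.rd (Bdd.const _)
  -- The denominator is written as the root of its square so that `Approx.div_sqrt` covers the
  -- division; the root disappears below since the denominator is nonnegative.
  have hq : Approx c (fun t => (c t).rd 1 / √((c t).rd ((c t).rd 1) * (c t).rd ((c t).rd 1)))
      (fun t => 1 / √(1 * 1)) :=
    Approx.div_sqrt h1 (hZ.mul hZ (Bdd.const _) (Bdd.const _)) (Bdd.const _) one_pos
      (fun t => by norm_num)
  obtain ⟨E, hE1, hE⟩ := hZ
  have hw := hq.rd (by simpa using Bdd.const 1)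
  have hfin := (((hw.mul hv (by simpa using Bdd.const 1) hbv).congr
    (b' := fun t => V t (sel t)) (by simp)).rd hbv).rd hbv
  obtain ⟨C, hC1, hC⟩ := hfin
  obtain ⟨D, hD1, hD⟩ := hsc
  have hg0 : 0 ≤ 4 * D / γ := by positivity
  refine ⟨C + D + 4 * D / γ + 2 * E, by linarith, fun t hg => ?_⟩
  have hCt := hC t (hg.mono (by linarith))
  refine le_of_eq_of_le ?_ (hCt.trans ?_)
  swap
  · have := hg.e_pos
    gcongr
    linarith
  have hN1 := hg.one_le_cast
  have e0 := hg.e_pos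
  have hnN : (n t : ℝ) ≤ (c t).N := by exact_mod_cast hn t
  have hn0 : (0 : ℝ) < n t := by exact_mod_cast (p t).pos
  have hsm : 4 * D / γ * ((c t).N : ℝ) ^ 4 * (c t).e ≤ 1 :=
    (hg.mono (by linarith : 4 * D / γ ≤ _)).small
  have hlt : 2 * (D * (c t).e) < γ / (n t : ℝ) ^ 4 := by
    rw [lt_div_iff₀ (by positivity)]
    have h4 : (n t : ℝ) ^ 4 ≤ ((c t).N : ℝ) ^ 4 := by gcongr
    have h5 : 4 * D * ((c t).N : ℝ) ^ 4 * (c t).e ≤ γ := by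
      have : 4 * D / γ * ((c t).N : ℝ) ^ 4 * (c t).e
        = (4 * D * ((c t).N : ℝ) ^ 4 * (c t).e) / γ := by ring
      rwa [this, div_le_one hγ] at hsm
    have h6 : D * (c t).e * (n t : ℝ) ^ 4 ≤ D * (c t).e * ((c t).N : ℝ) ^ 4 := by gcongr
    nlinarith
  have hs : ∀ j, |score t j - ideal t j| ≤ D * (c t).e := fun j => hD ⟨t, j⟩ (hg.mono (by linarith))
  have hmax : ∀ j ≤ p t, j ≠ sel t → score t j < score t (sel t) := fun j hj hne => by
    have g1 := hgap t j hj hne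
    have g2 := abs_le.1 (hs j)
    have g3 := abs_le.1 (hs (sel t))
    linarith
  have hiff : ∀ j ≤ p t, ((∀ k ≤ p t, score t k ≤ score t j) ↔ j = sel t) := fun j hj => by
    constructor
    · intro hk
      by_contra hne
      exact absurd (hk _ (hsel t)) (not_le.2 (hmax j hj hne))
    · rintro rfl k hk
      rcases eq_or_ne k (sel t) with rfl | hne
      · exact le_rfl
      · exact (hmax k hk hne).le
  have hZ0 : 0 ≤ (c t).rd ((c t).rd 1) := by
    have := abs_le.1 (hE t (hg.mono (by linarith)))
    have h2 : 2 * E * (c t).e ≤ 1 := (hg.mono (by linarith : 2 * E ≤ _)).e_le (by linarith)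
    nlinarith
  have hr0 := hg.rd_zero
  have hmem : sel t ∈ Finset.Iic (p t) := Finset.mem_Iic.2 (hsel t)
  congr 2
  unfold hardAttention
  have hZsum : ∑ j ∈ Finset.Iic (p t), (c t).rd (if ∀ k ≤ p t, score t k ≤ score t j then 1 else 0)
      = (c t).rd 1 := by
    rw [Finset.sum_eq_single_of_mem _ hmem]
    · rw [if_pos ((hiff _ (hsel t)).2 rfl)]
    · intro j hj hne
      rw [if_neg (fun hh => hne ((hiff j (Finset.mem_Iic.1 hj)).1 hh)), hr0]
  dsimp only
  rw [hZsum, Finset.sum_eq_single_of_mem _ hmem, if_pos ((hiff _ (hsel t)).2 rfl),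
    Real.sqrt_mul_self hZ0]
  intro j hj hne
  rw [if_neg (fun hh => hne ((hiff j (Finset.mem_Iic.1 hj)).1 hh)), hr0, zero_div, hr0, zero_mul,
    hr0]

end Heads

/-! ### Tracking an ideal residual stream through the sublayers -/

section Tracking

variable {ι : Type*} {m : ℕ} (N : ι → ℕ)

/-- A family of ideal residual streams, where instance `i` has `N i` positions. -/
abbrev Stream (m : ℕ) := ∀ i, Fin (N i) → Fin m → ℝ

/-- A rounding function, and a residual stream that is within `e` of an ideal one. -/
structure Run (H : Stream N m) where
  i : ι
  rd : ℝ → ℝ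
  e : ℝ
  x : Fin (N i) → Fin m → ℝ
  close : ∀ p a, |x p a - H i p a| ≤ e

variable {N}

def Run.ctx {H : Stream N m} (t : Run N H) : Ctx := ⟨t.rd, N t.i, t.e⟩

/-- The rounded computation `G` takes residual streams close to `H` to ones close to `H'`. -/
def Tracks (G : (ℝ → ℝ) → ∀ {n : ℕ}, (Fin n → Fin m → ℝ) → Fin n → Fin m → ℝ)
    (H H' : Stream N m) : Prop :=
  ∃ C, 1 ≤ C ∧ ∀ t : Run N H, t.ctx.Good C →
    ∀ p a, |G t.rd t.x p a - H' t.i p a| ≤ C * t.e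

/-- Each coordinate of the family of streams is bounded. -/
def BddStream (H : Stream N m) : Prop :=
  ∀ a, Bdd (T := Σ i, Fin (N i)) fun s => H s.1 s.2 a

variable {H H' H'' : Stream N m}
  {G G' : (ℝ → ℝ) → ∀ {n : ℕ}, (Fin n → Fin m → ℝ) → Fin n → Fin m → ℝ}

lemma Tracks.of_approx
    (h : ∀ a, Approx (T := Σ t : Run N H, Fin (N t.i)) (fun s => s.1.ctx)
      (fun s => G s.1.rd s.1.x s.2 a) (fun s => H' s.1.i s.2 a)) :
    Tracks G H H' := by
  choose C h1 hC using h
  have hle : ∀ a, C a ≤ 1 + ∑ b, C b := fun a => by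
    have := Finset.single_le_sum (f := C) (fun b _ => zero_le_one.trans (h1 b)) (Finset.mem_univ a)
    linarith
  refine ⟨1 + ∑ b, C b, ?_, fun t hg p a => ?_⟩
  · have : 0 ≤ ∑ b, C b := Finset.sum_nonneg fun b _ => zero_le_one.trans (h1 b)
    linarith
  · refine (hC a ⟨t, p⟩ (hg.mono (hle a))).trans ?_
    have : 0 < t.e := hg.e_pos
    exact mul_le_mul_of_nonneg_right (hle a) this.le

/-- The output of the first computation is a `Run` for the second one, with error `C * t.e`. -/
lemma Tracks.comp (h : Tracks G H H') (h' : Tracks G' H' H'') :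
    Tracks (fun rd _ x => G' rd (G rd x)) H H'' := by
  obtain ⟨C, h1, hC⟩ := h
  obtain ⟨D, h2, hD⟩ := h'
  refine ⟨C * D, by nlinarith, fun t hg p a => ?_⟩
  have := hD ⟨t.i, t.rd, C * t.e, G t.rd t.x, hC t (hg.mono (by nlinarith))⟩
    (hg.scale h1 (by linarith)) p a
  dsimp only at this ⊢
  linarith

lemma Tracks.congr (h : Tracks G H H') (e : ∀ i p a, H' i p a = H'' i p a) : Tracks G H H'' := by
  rwa [← (funext fun i => funext fun p => funext fun a => e i p a : H' = H'')]

lemma Run.approx (H : Stream N m) (a : Fin m) :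
    Approx (T := Σ t : Run N H, Fin (N t.i)) (fun s => s.1.ctx) (fun s => s.1.x s.2 a)
      (fun s => H s.1.i s.2 a) :=
  ⟨1, le_rfl, fun s _ => by rw [one_mul]; exact s.1.close s.2 a⟩

lemma BddStream.run (hb : BddStream H) (a : Fin m) :
    Bdd (T := Σ t : Run N H, Fin (N t.i)) (fun s => H s.1.i s.2 a) :=
  (hb a).comp (fun s : Σ t : Run N H, Fin (N t.i) => (⟨s.1.i, s.2⟩ : Σ i, Fin (N i)))

/-- The masked vectors have mean zero and are bounded away from zero. -/
structure Normalizable (mask : Fin m → ℚ) (H : Stream N m) : Prop where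
  bdd : BddStream H
  mean : ∀ i p, ∑ b, (mask b : ℝ) * H i p b = 0
  lower : ∃ c₀ : ℝ, 0 < c₀ ∧ ∀ i p, c₀ ≤ (∑ b, ((mask b : ℝ) * H i p b) ^ 2) / m

lemma Normalizable.approx {mask : Fin m → ℚ} (h : Normalizable mask H) (norm : NormKind)
    (a : Fin m) :
    Approx (T := Σ t : Run N H, Fin (N t.i)) (fun s => s.1.ctx)
      (fun s => maskedNorm norm s.1.rd mask (s.1.x s.2) a)
      (fun s => normalized mask (H s.1.i s.2) a) := by
  obtain ⟨c₀, h0, hc⟩ := h.lower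
  exact Approx.maskedNorm (c := fun s : Σ t : Run N H, Fin (N t.i) => s.1.ctx) norm mask
    (Run.approx H) h.bdd.run (fun s => h.mean _ _) h0 (fun s => hc _ _) a

lemma mulVecRd_of_zero {rd : ℝ → ℝ} (h0 : rd 0 = 0) {κ : Type*} {k : ℕ}
    {A : Matrix κ (Fin k) ℚ} {i : κ} (hA : ∀ j, A i j = 0) (x : Fin k → ℝ) :
    mulVecRd rd A x i = 0 := by
  have : ∀ k : ℕ, (List.ofFn fun _ : Fin k => (0 : ℝ)).foldl (fun a b => rd (a + b)) 0 = 0 := by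
    intro k
    induction k with
    | zero => simp
    | succ k ih => simpa [h0] using ih
  simp only [mulVecRd, hA, Rat.cast_zero, h0, zero_mul]
  exact this k

lemma dotRd_of_zero {rd : ℝ → ℝ} (h0 : rd 0 = 0) {k : ℕ} (y : Fin k → ℝ) :
    dotRd rd (fun _ => 0) y = 0 := by
  have := mulVecRd_of_zero h0 (κ := Unit) (k := k) (A := 0) (i := ()) (fun _ => rfl) y
  simpa [mulVecRd, dotRd, h0] using this

variable {h dh w : ℕ} (norm : NormKind)

lemma Feedforward.tracks (F : Feedforward m w) (hH : Normalizable F.mask H) :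
    Tracks (fun rd _ x => F.apply norm rd x) H (fun i p a => H i p a +
      ∑ b, (F.outer a b : ℝ) * max 0 (∑ c, (F.inner b c : ℝ) * normalized F.mask (H i p) c)) := by
  refine Tracks.of_approx fun a => ?_
  have hz := fun c => hH.approx norm c
  have bz := fun c => normalized_bdd (T := Σ t : Run N H, Fin (N t.i)) F.mask
    (fun s => H s.1.i s.2) c
  have bi : ∀ b, Bdd (T := Σ t : Run N H, Fin (N t.i)) (fun s => max 0 (∑ c, (F.inner b c : ℝ)
      * normalized F.mask (H s.1.i s.2) c)) := fun b =>
    (Bdd.sum _ fun c => (Bdd.const _).mul (bz c)).max_zero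
  have hi := fun b => ((Approx.mulVecRd F.inner hz bz b).max_zero).rd (bi b)
  have ho := Approx.mulVecRd F.outer hi bi a
  exact ((Run.approx H a).add ho).rd ((hH.bdd.run a).add
    (Bdd.sum _ fun b => (Bdd.const _).mul (bi b)))

/-- A zero update needs no lower bound on the norm: the zero matrix stays zero under rounding, so
only the rounding of the residual sum matters. This serves the idle sublayers. -/
lemma Feedforward.tracks_of_outer_eq_zero (F : Feedforward m w) (hF : F.outer = 0)
    (hH : BddStream H) : Tracks (fun rd _ x => F.apply norm rd x) H H := by
  refine Tracks.of_approx fun a => ?_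
  obtain ⟨C, h1, hC⟩ := (Run.approx H a).rd (hH.run a)
  refine ⟨C, h1, fun s hg => ?_⟩
  have := hC s hg
  simp only [Feedforward.apply, hF]
  have h0 : s.1.rd 0 = 0 := hg.rd_zero
  rw [mulVecRd_of_zero h0 (fun _ => rfl), add_zero]
  exact this

lemma Attention.tracks_of_out_eq_zero (A : Attention m h dh) (hA : A.out = 0)
    (hH : BddStream H) : Tracks (fun rd _ x => A.apply norm rd x) H H := by
  refine Tracks.of_approx fun a => ?_
  obtain ⟨C, h1, hC⟩ := (Run.approx H a).rd (hH.run a)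
  refine ⟨C, h1, fun s hg => ?_⟩
  have := hC s hg
  simp only [Attention.apply, hA]
  have h0 : s.1.rd 0 = 0 := hg.rd_zero
  rw [mulVecRd_of_zero h0 (fun _ => rfl), add_zero]
  exact this

/-- The exact value vectors of all heads, concatenated. -/
def Attention.idealValue (A : Attention m h dh) (v : Fin m → ℝ) (c : Fin (h * dh)) : ℝ :=
  ∑ b, (A.value (finProdFinEquiv.symm c).1 (finProdFinEquiv.symm c).2 b : ℝ) *
    normalized A.mask v b

/-- The exact attention score in head `k` of query position `v` and key position `v'`. -/
def Attention.idealScore (A : Attention m h dh) (k : Fin h) (v v' : Fin m → ℝ) : ℝ :=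
  ∑ l, (∑ b, (A.query k l b : ℝ) * normalized A.mask v b) *
    (∑ b, (A.key k l b : ℝ) * normalized A.mask v' b)

lemma Attention.idealValue_bdd {T : Type*} (A : Attention m h dh) (v : T → Fin m → ℝ)
    (c : Fin (h * dh)) : Bdd (fun t => A.idealValue (v t) c) :=
  Bdd.sum _ fun b => (Bdd.const _).mul (normalized_bdd _ v b)

lemma Attention.value_approx (A : Attention m h dh) (hH : Normalizable A.mask H)
    (c : Fin (h * dh)) :
    Approx (T := Σ s : (Σ t : Run N H, Fin (N t.i)), Fin (N s.1.i)) (fun s => s.1.1.ctx)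
      (fun s => mulVecRd s.1.1.rd (A.value (finProdFinEquiv.symm c).1)
        (maskedNorm norm s.1.1.rd A.mask (s.1.1.x s.2)) (finProdFinEquiv.symm c).2)
      (fun s => A.idealValue (H s.1.1.i s.2) c) :=
  (Approx.mulVecRd (A.value (finProdFinEquiv.symm c).1) (fun c => hH.approx norm c)
    (fun c => normalized_bdd (T := Σ t : Run N H, Fin (N t.i)) A.mask (fun s => H s.1.i s.2) c)
    (finProdFinEquiv.symm c).2).comp
      (fun s : (Σ s : (Σ t : Run N H, Fin (N t.i)), Fin (N s.1.i)) =>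
        (⟨s.1.1, s.2⟩ : Σ t : Run N H, Fin (N t.i)))

/-- With zero queries all computed scores are exactly `0`, so the ties survive rounding. -/
lemma Attention.tracks_uniform (A : Attention m h dh) (hH : Normalizable A.mask H)
    (hq : ∀ k, A.query k = 0) :
    Tracks (fun rd _ x => A.apply norm rd x) H (fun i p a => H i p a +
      ∑ c, (A.out a c : ℝ) *
        ((∑ j ∈ Finset.Iic p, A.idealValue (H i j) c) / ((p : ℕ) + 1))) := by
  refine Tracks.of_approx fun a => ?_
  have hv := fun c => Approx.hardAttention_uniform
    (c := fun s : Σ t : Run N H, Fin (N t.i) => s.1.ctx) (n := fun s => N s.1.i)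
    (fun s => s.2) (fun _ => le_rfl)
    (score := fun s j => dotRd s.1.rd
      (mulVecRd s.1.rd (A.query (finProdFinEquiv.symm c).1)
        (maskedNorm norm s.1.rd A.mask (s.1.x s.2)))
      (mulVecRd s.1.rd (A.key (finProdFinEquiv.symm c).1)
        (maskedNorm norm s.1.rd A.mask (s.1.x j))))
    (fun s h0 j k => by
      have h0' : s.1.rd 0 = 0 := h0
      have : mulVecRd s.1.rd (A.query (finProdFinEquiv.symm c).1)
          (maskedNorm norm s.1.rd A.mask (s.1.x s.2)) = fun _ => 0 := by
        funext l
        exact mulVecRd_of_zero h0' (fun _ => by rw [hq]; rfl) _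
      rw [this, dotRd_of_zero h0', dotRd_of_zero h0'])
    (val := fun s j => mulVecRd s.1.rd (A.value (finProdFinEquiv.symm c).1)
      (maskedNorm norm s.1.rd A.mask (s.1.x j)) (finProdFinEquiv.symm c).2)
    (V := fun s j => A.idealValue (H s.1.i j) c) (A.value_approx norm hH c)
    (A.idealValue_bdd
      (fun s : (Σ s : (Σ t : Run N H, Fin (N t.i)), Fin (N s.1.i)) => H s.1.1.i s.2) c)
  have hb : ∀ c, Bdd (T := Σ t : Run N H, Fin (N t.i)) (fun s =>
      (∑ j ∈ Finset.Iic s.2, A.idealValue (H s.1.i j) c) / ((s.2 : ℕ) + 1)) := fun c => by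
    obtain ⟨B, h0, hB⟩ := A.idealValue_bdd
      (fun s : (Σ s : (Σ t : Run N H, Fin (N t.i)), Fin (N s.1.i)) => H s.1.1.i s.2) c
    refine ⟨B, h0, fun s => ?_⟩
    have hp : (0 : ℝ) < (s.2 : ℕ) + 1 := by positivity
    rw [abs_div, abs_of_pos hp, div_le_iff₀ hp]
    refine (Finset.abs_sum_le_sum_abs _ _).trans ?_
    refine (Finset.sum_le_sum fun j _ => hB ⟨s, j⟩).trans ?_
    simp [mul_comm]
  exact ((Run.approx H a).add (Approx.mulVecRd A.out hv hb a)).rd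
    ((hH.bdd.run a).add (Bdd.sum _ fun b => (Bdd.const _).mul (hb b)))

lemma Attention.tracks_select (A : Attention m h dh) (hH : Normalizable A.mask H)
    (sel : ∀ i, Fin (N i) → Fin (N i)) (hsel : ∀ i p, sel i p ≤ p) {γ : ℝ} (hγ : 0 < γ)
    (hgap : ∀ k i p, ∀ j ≤ p, j ≠ sel i p → A.idealScore k (H i p) (H i j) + γ / (N i : ℝ) ^ 4
      ≤ A.idealScore k (H i p) (H i (sel i p))) :
    Tracks (fun rd _ x => A.apply norm rd x) H (fun i p a => H i p a +
      ∑ c, (A.out a c : ℝ) * A.idealValue (H i (sel i p)) c) := by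
  refine Tracks.of_approx fun a => ?_
  have hz := fun c => hH.approx norm c
  have bz := fun c => normalized_bdd (T := Σ t : Run N H, Fin (N t.i)) A.mask
    (fun s => H s.1.i s.2) c
  have hsc : ∀ k, Approx (T := Σ s : (Σ t : Run N H, Fin (N t.i)), Fin (N s.1.i))
      (fun s => s.1.1.ctx)
      (fun s => dotRd s.1.1.rd
        (mulVecRd s.1.1.rd (A.query k) (maskedNorm norm s.1.1.rd A.mask (s.1.1.x s.1.2)))
        (mulVecRd s.1.1.rd (A.key k) (maskedNorm norm s.1.1.rd A.mask (s.1.1.x s.2))))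
      (fun s => A.idealScore k (H s.1.1.i s.1.2) (H s.1.1.i s.2)) := fun k => by
    let φ : (Σ s : (Σ t : Run N H, Fin (N t.i)), Fin (N s.1.i)) → Σ t : Run N H, Fin (N t.i) :=
      fun s => ⟨s.1.1, s.2⟩
    exact Approx.dotRd (fun l => (Approx.mulVecRd (A.query k) hz bz l).comp Sigma.fst)
      (fun l => (Bdd.sum _ fun b => (Bdd.const _).mul (bz b)).comp Sigma.fst)
      (fun l => (Approx.mulVecRd (A.key k) hz bz l).comp φ)
      (fun l => (Bdd.sum _ fun b => (Bdd.const _).mul (bz b)).comp φ)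
  have hv := fun c => Approx.hardAttention_select
    (c := fun s : Σ t : Run N H, Fin (N t.i) => s.1.ctx) (n := fun s => N s.1.i)
    (fun s => s.2) (fun s => sel s.1.i s.2) (fun _ => le_rfl)
    (score := fun s j => dotRd s.1.rd
      (mulVecRd s.1.rd (A.query (finProdFinEquiv.symm c).1)
        (maskedNorm norm s.1.rd A.mask (s.1.x s.2)))
      (mulVecRd s.1.rd (A.key (finProdFinEquiv.symm c).1)
        (maskedNorm norm s.1.rd A.mask (s.1.x j))))
    (ideal := fun s j => A.idealScore (finProdFinEquiv.symm c).1 (H s.1.i s.2) (H s.1.i j)) hγ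
    (hsc (finProdFinEquiv.symm c).1) (fun s => hsel _ _) (fun s => hgap _ _ _)
    (val := fun s j => mulVecRd s.1.rd (A.value (finProdFinEquiv.symm c).1)
      (maskedNorm norm s.1.rd A.mask (s.1.x j)) (finProdFinEquiv.symm c).2)
    (V := fun s j => A.idealValue (H s.1.i j) c) (A.value_approx norm hH c)
    (A.idealValue_bdd
      (fun s : (Σ s : (Σ t : Run N H, Fin (N t.i)), Fin (N s.1.i)) => H s.1.1.i s.2) c)
  have hb : ∀ c, Bdd (T := Σ t : Run N H, Fin (N t.i)) (fun s =>
      A.idealValue (H s.1.i (sel s.1.i s.2)) c) := fun c => A.idealValue_bdd _ c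
  exact ((Run.approx H a).add (Approx.mulVecRd A.out hv hb a)).rd
    ((hH.bdd.run a).add (Bdd.sum _ fun b => (Bdd.const _).mul (hb b)))

end Tracking

/-! ### Antisymmetric residual streams

Each logical coordinate is stored together with its negation, so that all means vanish. -/

section Lift

variable {I J : Type} {m w : ℕ} (E : I × Bool ≃ Fin m) (EJ : J ≃ Fin w)

/-- The vector of dimension `m` that stores `f` and `-f`. -/
def lift (f : I → ℝ) (a : Fin m) : ℝ :=
  if (E.symm a).2 then f (E.symm a).1 else -f (E.symm a).1

lemma lift_add (f g : I → ℝ) (a : Fin m) : lift E f a + lift E g a = lift E (fun s => f s + g s) a := by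
  unfold lift
  split_ifs <;> ring

/-- The mask that treats both copies of a coordinate in the same way. -/
def liftMask (μ : I → ℚ) (a : Fin m) : ℚ := μ (E.symm a).1

lemma liftMask_mul_lift (μ : I → ℚ) (f : I → ℝ) (a : Fin m) :
    (liftMask E μ a : ℝ) * lift E f a = lift E (fun s => μ s * f s) a := by
  unfold lift liftMask
  split_ifs <;> ring

variable {ι : Type*} {N : ι → ℕ} {f f' : ∀ i, Fin (N i) → I → ℝ}

/-- The logical state is bounded. -/
def BddState (f : ∀ i, Fin (N i) → I → ℝ) : Prop := ∃ B : ℝ, ∀ i p s, |f i p s| ≤ B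

lemma BddState.stream (h : BddState f) : BddStream (m := m) fun i p => lift E (f i p) := by
  obtain ⟨B, hB⟩ := h
  refine fun a => Bdd.of_le B fun s => ?_
  beta_reduce
  unfold lift
  split_ifs
  · exact hB _ _ _
  · rw [abs_neg]
    exact hB _ _ _

variable [Fintype I] [Fintype J]

lemma sum_fin_eq (g : Fin m → ℝ) : ∑ a, g a = ∑ s, (g (E (s, true)) + g (E (s, false))) := by
  rw [← E.sum_comp, Fintype.sum_prod_type]
  simp

lemma sum_lift (f : I → ℝ) : ∑ a, lift E f a = 0 := by
  simp [sum_fin_eq E, lift]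

lemma sum_lift_mul (f g : I → ℝ) : ∑ a, lift E f a * lift E g a = 2 * ∑ s, f s * g s := by
  simp only [sum_fin_eq E, lift, Equiv.symm_apply_apply, Finset.mul_sum]
  exact Finset.sum_congr rfl fun s _ => by simp; ring

lemma card_eq (E : I × Bool ≃ Fin m) : (m : ℝ) = 2 * Fintype.card I := by
  have := Fintype.card_congr E
  simp only [Fintype.card_prod, Fintype.card_bool, Fintype.card_fin] at this
  rw [← this]
  push_cast
  ring

/-- Normalization of the logical vector `μ ⊙ f`. -/
def unitize (μ : I → ℚ) (f : I → ℝ) (s : I) : ℝ :=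
  μ s * f s / √((∑ b, (μ b * f b) ^ 2) / Fintype.card I)

lemma sum_liftMask_sq (μ : I → ℚ) (f : I → ℝ) :
    (∑ a, ((liftMask E μ a : ℝ) * lift E f a) ^ 2) / m
      = (∑ b, (μ b * f b) ^ 2) / Fintype.card I := by
  simp only [liftMask_mul_lift, pow_two, sum_lift_mul, card_eq E]
  rw [mul_div_mul_left _ _ two_ne_zero]

lemma normalized_lift (μ : I → ℚ) (f : I → ℝ) (a : Fin m) :
    normalized (liftMask E μ) (lift E f) a = lift E (unitize μ f) a := by
  rw [normalized, sum_liftMask_sq, liftMask_mul_lift]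
  unfold lift unitize
  split_ifs <;> ring

/-- The matrix that reads positive copies, and writes both copies. -/
def liftMatrix (M : I → I → ℚ) (a b : Fin m) : ℚ :=
  if (E.symm b).2 then
    if (E.symm a).2 then M (E.symm a).1 (E.symm b).1 else -M (E.symm a).1 (E.symm b).1
  else 0

lemma sum_liftMatrix (M : I → I → ℚ) (f : I → ℝ) (a : Fin m) :
    ∑ b, (liftMatrix E M a b : ℝ) * lift E f b = lift E (fun s => ∑ b, (M s b : ℝ) * f b) a := by
  simp only [sum_fin_eq E, lift, liftMatrix, Equiv.symm_apply_apply]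
  by_cases h : (E.symm a).2 = true <;> simp [h]

/-- The single-head attention sublayer given by logical matrices. -/
def liftAttention (μ : I → ℚ) (q k v : I → I → ℚ) : Attention m 1 m where
  mask := liftMask E μ
  query _ := liftMatrix E q
  key _ := liftMatrix E k
  value _ := liftMatrix E v
  out a c := if (finProdFinEquiv.symm c).2 = a then 1 else 0

/-- The feedforward sublayer given by logical matrices. -/
def liftFeedforward (μ : I → ℚ) (inner : J → I → ℚ) (outer : I → J → ℚ) : Feedforward m w where
  mask := liftMask E μ
  inner b a := if (E.symm a).2 then inner (EJ.symm b) (E.symm a).1 else 0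
  outer a b := if (E.symm a).2 then outer (E.symm a).1 (EJ.symm b)
    else -outer (E.symm a).1 (EJ.symm b)

lemma normalizable_lift {μ : I → ℚ} (hb : BddState f) {c₀ : ℝ} (h0 : 0 < c₀)
    (hf : ∀ i p, c₀ ≤ ∑ b, ((μ b : ℝ) * f i p b) ^ 2) :
    Normalizable (liftMask E μ) (fun i p => lift E (f i p)) where
  bdd := hb.stream E
  mean i p := by simp only [liftMask_mul_lift, sum_lift]
  lower := by
    rcases isEmpty_or_nonempty I with hI | hI
    · refine ⟨1, one_pos, fun i p => ?_⟩
      have := hf i p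
      simp only [Finset.univ_eq_empty, Finset.sum_empty] at this
      linarith
    · have hc : (0 : ℝ) < Fintype.card I := by exact_mod_cast Fintype.card_pos
      refine ⟨c₀ / Fintype.card I, by positivity, fun i p => ?_⟩
      rw [sum_liftMask_sq]
      gcongr
      exact hf i p

lemma sum_out (v : Fin m → ℝ) (a : Fin m) :
    ∑ c : Fin (1 * m), (((if (finProdFinEquiv.symm c).2 = a then 1 else 0 : ℚ)) : ℝ) *
      v (finProdFinEquiv.symm c).2 = v a := by
  rw [← finProdFinEquiv.sum_comp, Fintype.sum_prod_type]
  simp only [Equiv.symm_apply_apply, Finset.univ_unique, Finset.sum_singleton]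
  rw [Finset.sum_eq_single a (fun b _ hb => by simp [hb]) (fun h => absurd (Finset.mem_univ a) h)]
  simp

variable (norm : NormKind)

lemma liftAttention_tracks_uniform {μ : I → ℚ} {k v : I → I → ℚ} (hb : BddState f) {c₀ : ℝ}
    (h0 : 0 < c₀) (hf : ∀ i p, c₀ ≤ ∑ b, ((μ b : ℝ) * f i p b) ^ 2)
    (hf' : ∀ i p s, f' i p s = f i p s +
      (∑ j ∈ Finset.Iic p, ∑ b, (v s b : ℝ) * unitize μ (f i j) b) / ((p : ℕ) + 1)) :
    Tracks (fun rd _ x => (liftAttention E μ (fun _ _ => 0) k v).apply norm rd x)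
      (fun i p => lift E (f i p)) (fun i p => lift E (f' i p)) := by
  refine (Attention.tracks_uniform norm (liftAttention E μ (fun _ _ => 0) k v)
    (normalizable_lift E hb h0 hf) (fun _ => ?_)).congr fun i p a => ?_
  · ext a b
    simp [liftAttention, liftMatrix]
  · simp only [Attention.idealValue, liftAttention, normalized_lift, sum_liftMatrix]
    rw [sum_out (fun l => (∑ j ∈ Finset.Iic p, lift E (fun s => ∑ b, (v s b : ℝ) *
      unitize μ (f i j) b) l) / ((p : ℕ) + 1))]
    have : f' i p = fun s => f i p s +
      (∑ j ∈ Finset.Iic p, ∑ b, (v s b : ℝ) * unitize μ (f i j) b) / ((p : ℕ) + 1) :=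
      funext (hf' i p)
    rw [this, ← lift_add]
    congr 1
    unfold lift
    split_ifs
    · rfl
    · rw [Finset.sum_neg_distrib]
      ring

lemma liftAttention_tracks_select {μ : I → ℚ} {q k v : I → I → ℚ} (hb : BddState f) {c₀ : ℝ}
    (h0 : 0 < c₀) (hf : ∀ i p, c₀ ≤ ∑ b, ((μ b : ℝ) * f i p b) ^ 2)
    (sel : ∀ i, Fin (N i) → Fin (N i)) (hsel : ∀ i p, sel i p ≤ p) {γ : ℝ} (hγ : 0 < γ)
    {score : ∀ i, Fin (N i) → Fin (N i) → ℝ}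
    (hscore : ∀ i p j, score i p j = ∑ l, (∑ b, (q l b : ℝ) * unitize μ (f i p) b) *
      ∑ b, (k l b : ℝ) * unitize μ (f i j) b)
    (hgap : ∀ i p, ∀ j ≤ p, j ≠ sel i p →
      score i p j + γ / (N i : ℝ) ^ 4 ≤ score i p (sel i p))
    (hf' : ∀ i p s, f' i p s = f i p s + ∑ b, (v s b : ℝ) * unitize μ (f i (sel i p)) b) :
    Tracks (fun rd _ x => (liftAttention E μ q k v).apply norm rd x)
      (fun i p => lift E (f i p)) (fun i p => lift E (f' i p)) := by
  refine (Attention.tracks_select norm (liftAttention E μ q k v)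
    (normalizable_lift E hb h0 hf) sel hsel hγ (fun h i p j hj hne => ?_)).congr fun i p a => ?_
  -- The two copies contribute equally to the score; the factor 2 only widens the gap.
  · have hs : ∀ j, (liftAttention E μ q k v).idealScore h (lift E (f i p)) (lift E (f i j))
        = 2 * score i p j := fun j => by
      simp only [Attention.idealScore, liftAttention, normalized_lift, sum_liftMatrix,
        sum_lift_mul, hscore]
    rw [hs, hs]
    have := hgap i p j hj hne
    have : 0 ≤ γ / (N i : ℝ) ^ 4 := by positivity
    linarith
  · simp only [Attention.idealValue, liftAttention, normalized_lift, sum_liftMatrix]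
    rw [sum_out (fun l => lift E (fun s => ∑ b, (v s b : ℝ) * unitize μ (f i (sel i p)) b) l),
      lift_add]
    congr 1
    exact (funext (hf' i p)).symm

lemma liftFeedforward_tracks {μ : I → ℚ} {inner : J → I → ℚ} {outer : I → J → ℚ}
    (hb : BddState f) {c₀ : ℝ} (h0 : 0 < c₀)
    (hf : ∀ i p, c₀ ≤ ∑ b, ((μ b : ℝ) * f i p b) ^ 2)
    (hf' : ∀ i p s, f' i p s = f i p s +
      ∑ j, (outer s j : ℝ) * max 0 (∑ b, (inner j b : ℝ) * unitize μ (f i p) b)) :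
    Tracks (fun rd _ x => (liftFeedforward E EJ μ inner outer).apply norm rd x)
      (fun i p => lift E (f i p)) (fun i p => lift E (f' i p)) := by
  refine (Feedforward.tracks norm (liftFeedforward E EJ μ inner outer)
    (normalizable_lift E hb h0 hf)).congr fun i p a => ?_
  have hin : ∀ j : J, ∑ c, (((if (E.symm c).2 then inner j (E.symm c).1 else 0 : ℚ)) : ℝ) *
      lift E (unitize μ (f i p)) c = ∑ b, (inner j b : ℝ) * unitize μ (f i p) b := fun j => by
    simp [sum_fin_eq E, lift]
  simp only [liftFeedforward, normalized_lift, hin]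
  rw [← EJ.sum_comp]
  simp only [Equiv.symm_apply_apply]
  rw [(funext (hf' i p) : f' i p = _), ← lift_add]
  congr 1
  unfold lift
  split_ifs
  · rfl
  · simp

end Lift

/-! ### The logical coordinates -/

/-- Logical coordinates: the bits of the current window (`bit`) and of the retrieved one (`recv`),
two-dimensional unit vectors pointing to a position (`ptr`, `recvPtr`, `key`), unnormalized ones
(`rawKey`, `rawPtr`), the marker of the first position, the verdict and constant padding. -/
inductive Slot (B l : ℕ) : Type
  | bit (a : Fin B)
  | recv (a : Fin B)
  | ptr (c : Fin 2)
  | recvPtr (c : Fin 2)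
  | key (c : Fin 2)
  | rawKey (c : Fin 2)
  | rawPtr (c : Fin 2)
  | mark (c : Fin 2)
  | verdict
  | pad (a : Fin l)

namespace Slot

variable {B l : ℕ}

def equiv : Slot B l ≃
    Fin B ⊕ Fin B ⊕ Fin 2 ⊕ Fin 2 ⊕ Fin 2 ⊕ Fin 2 ⊕ Fin 2 ⊕ Fin 2 ⊕ Unit ⊕ Fin l where
  toFun
    | bit a => .inl a
    | recv a => .inr (.inl a)
    | ptr c => .inr (.inr (.inl c))
    | recvPtr c => .inr (.inr (.inr (.inl c)))
    | key c => .inr (.inr (.inr (.inr (.inl c))))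
    | rawKey c => .inr (.inr (.inr (.inr (.inr (.inl c)))))
    | rawPtr c => .inr (.inr (.inr (.inr (.inr (.inr (.inl c))))))
    | mark c => .inr (.inr (.inr (.inr (.inr (.inr (.inr (.inl c)))))))
    | verdict => .inr (.inr (.inr (.inr (.inr (.inr (.inr (.inr (.inl ()))))))))
    | pad a => .inr (.inr (.inr (.inr (.inr (.inr (.inr (.inr (.inr a))))))))
  invFun
    | .inl a => bit a
    | .inr (.inl a) => recv a
    | .inr (.inr (.inl c)) => ptr c
    | .inr (.inr (.inr (.inl c))) => recvPtr c
    | .inr (.inr (.inr (.inr (.inl c)))) => key c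
    | .inr (.inr (.inr (.inr (.inr (.inl c))))) => rawKey c
    | .inr (.inr (.inr (.inr (.inr (.inr (.inl c)))))) => rawPtr c
    | .inr (.inr (.inr (.inr (.inr (.inr (.inr (.inl c))))))) => mark c
    | .inr (.inr (.inr (.inr (.inr (.inr (.inr (.inr (.inl _)))))))) => verdict
    | .inr (.inr (.inr (.inr (.inr (.inr (.inr (.inr (.inr a)))))))) => pad a
  left_inv s := by cases s <;> rfl
  right_inv s := by
    rcases s with a | a | a | a | a | a | a | a | a | a <;> rfl

instance : Fintype (Slot B l) := Fintype.ofEquiv _ equiv.symm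

lemma card_eq : Fintype.card (Slot B l) = 2 * B + 13 + l := by
  rw [Fintype.card_congr equiv]
  simp only [Fintype.card_sum, Fintype.card_fin, Fintype.card_unit]
  ring

lemma sum_eq (g : Slot B l → ℝ) : ∑ s, g s = ∑ a, g (bit a) + ∑ a, g (recv a) +
    (g (ptr 0) + g (ptr 1)) + (g (recvPtr 0) + g (recvPtr 1)) + (g (key 0) + g (key 1)) +
    (g (rawKey 0) + g (rawKey 1)) + (g (rawPtr 0) + g (rawPtr 1)) + (g (mark 0) + g (mark 1)) +
    g verdict + ∑ a, g (pad a) := by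
  rw [← equiv.symm.sum_comp]
  simp only [Fintype.sum_sum_type, Fin.sum_univ_two, Finset.univ_unique, Finset.sum_singleton,
    equiv, Equiv.coe_fn_symm_mk]
  ring

end Slot

/-- A truth value as a rational number `±1`. -/
def sign (b : Bool) : ℚ := if b then 1 else -1

lemma sign_mul_self (b : Bool) : (sign b : ℝ) * sign b = 1 := by cases b <;> norm_num [sign]

lemma abs_sign (b : Bool) : |(sign b : ℝ)| = 1 := by cases b <;> norm_num [sign]

/-- The contents of the residual stream at one position. -/
structure Cell (B : ℕ) where
  bit : Fin B → Bool
  recv : Fin B → Bool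
  ptr : Fin 2 → ℝ
  recvPtr : Fin 2 → ℝ
  key : Fin 2 → ℝ
  rawKey : Fin 2 → ℝ
  rawPtr : Fin 2 → ℝ
  mark : Fin 2 → ℝ

/-! ### Cells, parameter matrices, and the sublayers that produce keys -/

section Sublayers

variable {B l : ℕ} (F : (Fin B → Bool) → Bool)
  (op : (Fin B → Bool) → (Fin B → Bool) → Fin B → Bool)

/-- The logical vector of a cell; the verdict is `F` of the bits. -/
def Cell.vec (s : Cell B) : Slot B l → ℝ
  | .bit a => sign (s.bit a)
  | .recv a => sign (s.recv a)
  | .ptr c => s.ptr c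
  | .recvPtr c => s.recvPtr c
  | .key c => s.key c
  | .rawKey c => s.rawKey c
  | .rawPtr c => s.rawPtr c
  | .mark c => s.mark c
  | .verdict => sign (F s.bit)
  | .pad _ => 1

structure Cell.Small (s : Cell B) : Prop where
  ptr : ∀ c, |s.ptr c| ≤ 1
  recvPtr : ∀ c, |s.recvPtr c| ≤ 1
  key : ∀ c, |s.key c| ≤ 1
  rawKey : ∀ c, |s.rawKey c| ≤ 1
  rawPtr : ∀ c, |s.rawPtr c| ≤ 1
  mark : ∀ c, |s.mark c| ≤ 1

lemma Cell.Small.abs_vec_le {s : Cell B} (h : s.Small) (i : Slot B l) : |s.vec F i| ≤ 1 := by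
  cases i with
  | bit a => exact (abs_sign _).le
  | recv a => exact (abs_sign _).le
  | ptr c => exact h.ptr c
  | recvPtr c => exact h.recvPtr c
  | key c => exact h.key c
  | rawKey c => exact h.rawKey c
  | rawPtr c => exact h.rawPtr c
  | mark c => exact h.mark c
  | verdict => exact (abs_sign _).le
  | pad a => exact abs_one.le

/-- Hidden units: a lookup table for pairs of bit vectors, and one unit per coordinate. -/
abbrev Hidden (B l : ℕ) : Type := ((Fin B → Bool) × (Fin B → Bool)) ⊕ Slot B l

def markMask : Slot B l → ℚ
  | .mark _ => 1
  | _ => 0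

def rawKeyMask : Slot B l → ℚ
  | .rawKey _ => 1
  | _ => 0

def rawPtrMask : Slot B l → ℚ
  | .rawPtr _ => 1
  | .ptr _ => 1
  | _ => 0

/-- With weight 2, each of the unit vectors `ptr`, `recvPtr`, `key` has squared length 4. Together
with `mark`, bits and padding this gives 12 + 1 + 2B + l, the number of slots, so the root mean
square is 1 and layer-norm is the identity. -/
def mainMask : Slot B l → ℚ
  | .bit _ => 1
  | .recv _ => 1
  | .ptr _ => 2
  | .recvPtr _ => 2
  | .key _ => 2
  | .mark _ => 1
  | .pad _ => 1
  | _ => 0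

/-- Value matrix of the uniform attention head that produces the unnormalized vectors. -/
def averageValue (k : ℕ) (σ : ℚ) : Slot B l → Slot B l → ℚ
  | .rawKey c, .mark d => if c = 0 then (if d = 0 then σ / k else 0) else σ / k
  | .rawPtr c, .mark d => if c = d then σ / k else 0
  | _, _ => 0

def keyInner : Hidden B l → Slot B l → ℚ
  | .inr (.rawKey c), .rawKey d => if c = d then 1 else 0
  | _, _ => 0

/-- The entry `1 / k` cancels the factor k by which layer-norm scales a unit vector among k²
coordinates. -/
def keyOuter (k : ℕ) : Slot B l → Hidden B l → ℚ
  | .key c, .inr (.rawKey d) => if c = d then 1 / k else 0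
  | _, _ => 0

/-- The entries `-1` form a gate. A pointer that is set has nonnegative coordinates of sum at least
1 and silences the unit; an unset pointer is zero and lets `rawPtr` through. Thus the repeated block
initializes pointers in the first round only. -/
def ptrInner : Hidden B l → Slot B l → ℚ
  | .inr (.rawPtr c), .rawPtr d => if c = d then 1 else 0
  | .inr (.rawPtr _), .ptr _ => -1
  | _, _ => 0

def ptrOuter (k : ℕ) : Slot B l → Hidden B l → ℚ
  | .ptr c, .inr (.rawPtr d) => if c = d then 1 / k else 0
  | _, _ => 0

def mainQuery : Slot B l → Slot B l → ℚ
  | .key c, .ptr d => if c = d then 1 else 0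
  | _, _ => 0

def mainKey : Slot B l → Slot B l → ℚ
  | .key c, .key d => if c = d then 1 else 0
  | _, _ => 0

/-- All positions hold the same rest value in `recv` and `recvPtr`, so subtracting it at the
retrieved position cancels it at the querying one. The entries `1 / 2` undo the mask weight 2. -/
def mainValue : Slot B l → Slot B l → ℚ
  | .recv a, .bit b => if a = b then 1 else 0
  | .recv a, .recv b => if a = b then -1 else 0
  | .recvPtr c, .ptr d => if c = d then 1 / 2 else 0
  | .recvPtr c, .recvPtr d => if c = d then -1 / 2 else 0
  | _, _ => 0

/-- The two `mark` coordinates sum to 1, so their entries act as the threshold `1 - 2 * B` of the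
table units. The `.inr` units carry nonnegative coordinates through the ReLU unchanged. -/
def mainInner : Hidden B l → Slot B l → ℚ
  | .inl p, .recv a => sign (p.1 a)
  | .inl p, .bit a => sign (p.2 a)
  | .inl _, .mark _ => 1 - 2 * B
  | .inr (.recvPtr c), .recvPtr d => if c = d then 1 else 0
  | .inr (.ptr c), .ptr d => if c = d then 1 else 0
  | .inr (.key c), .key d => if c = d then 1 else 0
  | .inr (.mark c), .mark d => if c = d then 1 else 0
  | _, _ => 0

/-- Each row writes the new value minus the old one. The rest value of `recvPtr` is the unit vector
(1, 0) rather than zero, so that the masked norm is the same before and after retrieval; the `mark`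
units supply the constant 1. -/
def mainOuter : Slot B l → Hidden B l → ℚ
  | .bit a, .inl p => sign (op p.1 p.2 a) - sign (p.2 a)
  | .recv a, .inl p => 1 - sign (p.1 a)
  | .verdict, .inl p => sign (F (op p.1 p.2)) - sign (F p.2)
  | .ptr c, .inr (.recvPtr d) => if c = d then 1 / 2 else 0
  | .ptr c, .inr (.ptr d) => if c = d then -1 / 2 else 0
  | .recvPtr c, .inr (.recvPtr d) => if c = d then -1 / 2 else 0
  | .recvPtr c, .inr (.mark _) => if c = 0 then 1 else 0
  | .key c, .inr (.key d) => if c = d then -1 / 2 else 0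
  | _, _ => 0

/-- A perfect square number of slots makes the scale factor of layer-norm rational, so that rational
matrices can undo it. -/
lemma unitize_eq {k : ℕ} (hk : 0 < k) (hc : 2 * B + 13 + l = k ^ 2) {μ : Slot B l → ℚ}
    {f : Slot B l → ℝ} {r : ℝ} (hr : 0 ≤ r) (h : ∑ b, ((μ b : ℝ) * f b) ^ 2 = r ^ 2)
    (s : Slot B l) : unitize μ f s = μ s * f s * k / r := by
  have hk' : (0 : ℝ) < k := by exact_mod_cast hk
  rw [unitize, h, Slot.card_eq, hc]
  push_cast
  rw [← div_pow, Real.sqrt_sq (by positivity), div_div_eq_mul_div]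

variable {m w : ℕ} (E : Slot B l × Bool ≃ Fin m) (EJ : Hidden B l ≃ Fin w)
  {ι : Type*} {N : ι → ℕ} {s s' : ∀ i, Fin (N i) → Cell B} (norm : NormKind)

/-- The ideal residual stream given by cells. -/
def cellStream (s : ∀ i, Fin (N i) → Cell B) : Stream N m := fun i p => lift E ((s i p).vec F)

lemma bddState_vec (hs : ∀ i p, (s i p).Small) :
    BddState fun i p => ((s i p).vec F : Slot B l → ℝ) :=
  ⟨1, fun i p => (hs i p).abs_vec_le F⟩

/-- The marker of the first position. -/
def markVec {n : ℕ} (p : Fin n) : Fin 2 → ℝ := if (p : ℕ) = 0 then ![1, 0] else ![0, 1]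

lemma sum_markVec_zero {n : ℕ} (p : Fin n) : ∑ j ∈ Finset.Iic p, markVec j 0 = 1 := by
  rw [Finset.sum_eq_single_of_mem (⟨0, p.pos⟩ : Fin n) (by simp [Fin.le_def])]
  · simp [markVec]
  · intro b _ hb
    have : (b : ℕ) ≠ 0 := fun h => hb (Fin.ext h)
    simp [markVec, this]

lemma markVec_add {n : ℕ} (p : Fin n) : markVec p 0 + markVec p 1 = 1 := by
  unfold markVec
  split_ifs <;> simp

lemma markVec_sq {n : ℕ} (p : Fin n) : markVec p 0 ^ 2 + markVec p 1 ^ 2 = 1 := by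
  unfold markVec
  split_ifs <;> simp

lemma sum_markVec_one {n : ℕ} (p : Fin n) : ∑ j ∈ Finset.Iic p, markVec j 1 = (p : ℕ) := by
  have h : ∀ j : Fin n, markVec j 1 = 1 - markVec j 0 := fun j => by
    rw [← markVec_add j]
    ring
  simp [h, Finset.sum_sub_distrib, sum_markVec_zero]

/-- The unnormalized key `(1 / (p + 1), 1)`. -/
def rawKeyVec (p : ℕ) : Fin 2 → ℝ := ![1 / ((p : ℝ) + 1), 1]

/-- The unnormalized pointer `(1 / (p + 1), p / (p + 1))`. -/
def rawPtrVec (p : ℕ) : Fin 2 → ℝ := ![1 / ((p : ℝ) + 1), p / ((p : ℝ) + 1)]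

/-- The unit vector in direction `(1, v)`. -/
def dir (v : ℝ) : Fin 2 → ℝ := ![1 / √(1 + v ^ 2), v / √(1 + v ^ 2)]

lemma forall_fin_two {P : Fin 2 → Prop} : (∀ c, P c) ↔ P 0 ∧ P 1 := Fin.forall_fin_two

/-- Exactly one of the first p + 1 positions is marked as first, so the averages of the marker are
1/(p+1) and p/(p+1). With `σ = 1` the raw vectors are written, with `σ = -1` they are erased later
in the round. -/
lemma average_tracks {k : ℕ} (hk : 0 < k) (hc : 2 * B + 13 + l = k ^ 2) (σ : ℚ)
    (hs : ∀ i p, (s i p).Small) (hm : ∀ i p, (s i p).mark = markVec p)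
    (hs' : ∀ i p, s' i p = { s i p with
      rawKey := fun c => (s i p).rawKey c + σ * rawKeyVec p c
      rawPtr := fun c => (s i p).rawPtr c + σ * rawPtrVec p c }) :
    Tracks (fun rd _ x => (liftAttention E markMask (fun _ _ => 0) (fun _ _ => 0)
      (averageValue k σ)).apply norm rd x) (cellStream F E s) (cellStream F E s') := by
  have hk' : (0 : ℝ) < k := by exact_mod_cast hk
  have hsum : ∀ i p, ∑ b : Slot B l, ((markMask b : ℝ) * (s i p).vec F b) ^ 2 = 1 ^ 2 := fun i p => by
    simp [Slot.sum_eq, markMask, Cell.vec, hm, markVec_sq]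
  refine liftAttention_tracks_uniform E norm (bddState_vec F hs) one_pos
    (fun i p => by rw [hsum, one_pow]) fun i p a => ?_
  simp only [unitize_eq hk hc zero_le_one (hsum _ _), hs']
  have hp : ((p : ℕ) : ℝ) + 1 ≠ 0 := by positivity
  have e1 : ∀ j : Fin (N i), (σ : ℝ) / k * (markVec j 0 * k) = σ * markVec j 0 := fun j => by
    field_simp
  have e2 : ∀ j : Fin (N i), (σ : ℝ) / k * (markVec j 1 * k) = σ * markVec j 1 := fun j => by
    field_simp
  cases a with
  | rawKey c =>
    revert c
    refine forall_fin_two.2 ⟨?_, ?_⟩ <;>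
    simp [Slot.sum_eq, markMask, Cell.vec, hm, averageValue, rawKeyVec, e1, e2,
      Finset.sum_add_distrib, ← Finset.mul_sum, sum_markVec_zero, sum_markVec_one] <;> field_simp
    ring
  | rawPtr c =>
    revert c
    refine forall_fin_two.2 ⟨?_, ?_⟩ <;>
    simp [Slot.sum_eq, markMask, Cell.vec, hm, averageValue, rawPtrVec, e1, e2,
      ← Finset.mul_sum, sum_markVec_zero, sum_markVec_one] <;> field_simp
  | _ => simp [Cell.vec, averageValue]

lemma sum_hidden (g : Hidden B l → ℝ) :
    ∑ j, g j = ∑ p, g (.inl p) + ∑ t, g (.inr t) := Fintype.sum_sum_type g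

/-- Normalization forgets the scale of (1/(p+1), 1) and leaves the direction (1, p+1). -/
lemma key_tracks {k : ℕ} (hk : 0 < k) (hc : 2 * B + 13 + l = k ^ 2)
    (hs : ∀ i p, (s i p).Small) (hm : ∀ i p, (s i p).rawKey = rawKeyVec p)
    (hs' : ∀ i p, s' i p = { s i p with
      key := fun c => (s i p).key c + dir ((p : ℕ) + 1) c }) :
    Tracks (fun rd _ x => (liftFeedforward E EJ rawKeyMask keyInner (keyOuter k)).apply norm rd x)
      (cellStream F E s) (cellStream F E s') := by
  have hk' : (0 : ℝ) < k := by exact_mod_cast hk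
  have hsum : ∀ i (p : Fin (N i)), ∑ b : Slot B l, ((rawKeyMask b : ℝ) * (s i p).vec F b) ^ 2
      = (√(1 + ((p : ℕ) + 1 : ℝ) ^ 2) / ((p : ℕ) + 1)) ^ 2 := fun i p => by
    rw [div_pow, Real.sq_sqrt (by positivity)]
    simp [Slot.sum_eq, rawKeyMask, Cell.vec, hm, rawKeyVec]
    field_simp
  refine liftFeedforward_tracks E EJ norm (bddState_vec F hs) one_pos (fun i p => ?_)
    fun i p a => ?_
  · simp [Slot.sum_eq, rawKeyMask, Cell.vec, hm, rawKeyVec]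
    positivity
  simp only [unitize_eq hk hc (by positivity) (hsum _ _), hs', sum_hidden]
  have hq : 0 < √(1 + ((p : ℕ) + 1 : ℝ) ^ 2) := by positivity
  have hp : (0 : ℝ) < ((p : ℕ) : ℝ) + 1 := by positivity
  cases a with
  | key c =>
    revert c
    refine forall_fin_two.2 ⟨?_, ?_⟩ <;>
    simp [Slot.sum_eq, rawKeyMask, Cell.vec, hm, keyInner, keyOuter, rawKeyVec, dir] <;>
    rw [max_eq_right (by positivity)] <;> field_simp
  | _ => simp [Slot.sum_eq, Cell.vec, keyOuter]

end Sublayers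

/-! ### Unit vectors in the plane and the margin between them -/

lemma dir_sq (v : ℝ) : dir v 0 ^ 2 + dir v 1 ^ 2 = 1 := by
  have h : 0 < 1 + v ^ 2 := by positivity
  simp only [dir, Matrix.cons_val_zero, Matrix.cons_val_one, div_pow, Real.sq_sqrt h.le]
  field_simp

lemma dir_nonneg {v : ℝ} (hv : 0 ≤ v) : ∀ c, 0 ≤ dir v c :=
  forall_fin_two.2 ⟨by simp only [dir, Matrix.cons_val_zero]; positivity,
    by simp only [dir, Matrix.cons_val_one]; exact div_nonneg hv (Real.sqrt_nonneg _)⟩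

lemma abs_dir_le (v : ℝ) : ∀ c, |dir v c| ≤ 1 := by
  have h := dir_sq v
  exact forall_fin_two.2 ⟨(sq_le_one_iff_abs_le_one _).1 (by nlinarith [sq_nonneg (dir v 1)]),
    (sq_le_one_iff_abs_le_one _).1 (by nlinarith [sq_nonneg (dir v 0)])⟩

/-- For nonnegative coordinates the square of the sum is at least the sum of squares; this closes
the gate in `ptrInner`. -/
lemma one_le_dir_add {v : ℝ} (hv : 0 ≤ v) : 1 ≤ dir v 0 + dir v 1 := by
  nlinarith [dir_sq v, mul_nonneg (dir_nonneg hv 0) (dir_nonneg hv 1),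
    dir_nonneg hv 0, dir_nonneg hv 1]

/-- Inner product in the plane. -/
def dot (x y : Fin 2 → ℝ) : ℝ := x 0 * y 0 + x 1 * y 1

lemma dot_dir_self (v : ℝ) : dot (dir v) (dir v) = 1 := by
  rw [← dir_sq v, dot]
  ring

/-- The squared sine of the angle between (1, u) and (1, t) is (u - t)² / ((1 + u²)(1 + t²)), at
least 1/(4N⁴) for distinct integers. -/
lemma dot_dir_le {u t N : ℕ} (hN : 1 ≤ N) (hu : u ≤ N) (ht : t ≤ N) (hne : u ≠ t) :
    dot (dir u) (dir t) + 1 / 8 / (N : ℝ) ^ 4 ≤ 1 := by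
  have hN' : (1 : ℝ) ≤ N := by exact_mod_cast hN
  have hu' : (u : ℝ) ≤ N := by exact_mod_cast hu
  have ht' : (t : ℝ) ≤ N := by exact_mod_cast ht
  have hd : (1 : ℝ) ≤ ((u : ℝ) - t) ^ 2 := by
    have h1 : (1 : ℤ) ≤ ((u : ℤ) - t) ^ 2 := by
      have : (u : ℤ) - t ≠ 0 := by omega
      have := sq_pos_of_ne_zero this
      omega
    exact_mod_cast h1
  set a : ℝ := 1 + (u : ℝ) ^ 2 with ha
  set b : ℝ := 1 + (t : ℝ) ^ 2 with hb
  have ha0 : 0 < a := by positivity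
  have hb0 : 0 < b := by positivity
  have ha2 : a ≤ 2 * (N : ℝ) ^ 2 := by nlinarith [(Nat.cast_nonneg u : (0 : ℝ) ≤ u)]
  have hb2 : b ≤ 2 * (N : ℝ) ^ 2 := by nlinarith [(Nat.cast_nonneg t : (0 : ℝ) ≤ t)]
  have hx : dot (dir u) (dir t) ^ 2 = 1 - ((u : ℝ) - t) ^ 2 / (a * b) := by
    have : dot (dir u) (dir t) = (1 + (u : ℝ) * t) / (√a * √b) := by
      simp only [dot, dir, Matrix.cons_val_zero, Matrix.cons_val_one]
      field_simp
      rfl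
    rw [this, div_pow, mul_pow, Real.sq_sqrt ha0.le, Real.sq_sqrt hb0.le]
    field_simp
    rw [ha, hb]
    ring
  have hab : 1 / (4 * (N : ℝ) ^ 4) ≤ ((u : ℝ) - t) ^ 2 / (a * b) := by
    have : a * b ≤ 4 * (N : ℝ) ^ 4 := by
      calc a * b ≤ (2 * (N : ℝ) ^ 2) * (2 * (N : ℝ) ^ 2) := by gcongr
        _ = _ := by ring
    gcongr
  have h8 : 1 / 8 / (N : ℝ) ^ 4 ≤ 1 := by
    rw [div_div, div_le_one (by positivity)]
    nlinarith [one_le_pow₀ hN' (n := 4)]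
  have h9 : 1 / (4 * (N : ℝ) ^ 4) = 2 * (1 / 8 / (N : ℝ) ^ 4) := by
    field_simp
    norm_num
  -- With δ = 1/(8N⁴), the squared cosine is at most 1 - 2δ ≤ (1 - δ)².
  have := abs_le_of_sq_le_sq (a := dot (dir u) (dir t)) (b := 1 - 1 / 8 / (N : ℝ) ^ 4) (by
    rw [hx]
    nlinarith [sq_nonneg (1 / 8 / (N : ℝ) ^ 4)]) (by linarith)
  linarith [le_abs_self (dot (dir u) (dir t))]

/-- Pointer 0 stands for a target left of the input. Keys are numbered from 1, and (1, 0) is closest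
to key 1, the position of `BoS`, whose window is empty. -/
lemma dot_dir_gap {u t N : ℕ} (hu : u ≤ N) (ht1 : 1 ≤ t) (ht : t ≤ N) (hne : t ≠ max u 1) :
    dot (dir u) (dir t) + 1 / 8 / (N : ℝ) ^ 4 ≤ dot (dir u) (dir (max u 1 : ℕ)) := by
  rcases Nat.eq_zero_or_pos u with rfl | hu0
  · have ht2 : 2 ≤ t := by
      have : t ≠ 1 := by simpa using hne
      omega
    have ht2' : (2 : ℝ) ≤ t := by exact_mod_cast ht2
    have hN : (2 : ℝ) ≤ N := ht2'.trans (by exact_mod_cast ht)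
    -- Key 1 scores 1/√2 ≥ 1/1.5, every other key at most 1/√5 ≤ 1/2.2.
    have h5 : (22 / 10 : ℝ) ≤ √(1 + (t : ℝ) ^ 2) := Real.le_sqrt_of_sq_le (by nlinarith)
    have h2 : √(1 + (1 : ℝ) ^ 2) ≤ 15 / 10 := Real.sqrt_le_iff.2 ⟨by norm_num, by norm_num⟩
    have e1 : 1 / √(1 + (t : ℝ) ^ 2) ≤ 1 / (22 / 10) := by gcongr
    have e2 : 1 / (15 / 10) ≤ 1 / √(1 + (1 : ℝ) ^ 2) := by gcongr
    have e3 : 1 / 8 / (N : ℝ) ^ 4 ≤ 1 / 8 / 2 ^ 4 := by gcongr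
    have d : ∀ v : ℝ, dot (dir ((0 : ℕ) : ℝ)) (dir v) = 1 / √(1 + v ^ 2) := fun v => by
      simp [dot, dir]
    rw [d, d]
    simp only [zero_le, sup_of_le_right, Nat.cast_one]
    norm_num at e1 e2 e3 ⊢
    linarith
  · rw [max_eq_left hu0] at hne ⊢
    rw [dot_dir_self]
    exact dot_dir_le (Nat.le_trans hu0 hu) hu ht hne.symm

/-! ### Pointer initialization, retrieval and table lookup -/

section Sublayers

variable {B l : ℕ} (F : (Fin B → Bool) → Bool)
  (op : (Fin B → Bool) → (Fin B → Bool) → Fin B → Bool)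
  {m w : ℕ} (E : Slot B l × Bool ≃ Fin m) (EJ : Hidden B l ≃ Fin w)
  {ι : Type*} {N : ι → ℕ} {s s' : ∀ i, Fin (N i) → Cell B} (norm : NormKind)

lemma rawPtrVec_sq (p : ℕ) :
    rawPtrVec p 0 ^ 2 + rawPtrVec p 1 ^ 2 = (√(1 + (p : ℝ) ^ 2) / ((p : ℝ) + 1)) ^ 2 := by
  rw [div_pow, Real.sq_sqrt (by positivity)]
  simp only [rawPtrVec, Matrix.cons_val_zero, Matrix.cons_val_one, div_pow, one_pow]
  ring

/-- The minimum of (1 + p²)/(1 + p)² is attained at p = 1. It keeps the masked vector away from zero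
even while the pointer is unset. -/
lemma rawPtrVec_lower (p : ℕ) : (1 / 2 : ℝ) ≤ rawPtrVec p 0 ^ 2 + rawPtrVec p 1 ^ 2 := by
  have hp : (0 : ℝ) < (p : ℝ) + 1 := by positivity
  rw [rawPtrVec_sq, div_pow, Real.sq_sqrt (by positivity), le_div_iff₀ (by positivity)]
  nlinarith [sq_nonneg ((p : ℝ) - 1)]

lemma rawPtrVec_le (p : ℕ) : ∀ c, rawPtrVec p c ≤ 1 := by
  have hp : (0 : ℝ) < (p : ℝ) + 1 := by positivity
  have h0 : (0 : ℝ) ≤ p := by positivity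
  refine forall_fin_two.2 ⟨?_, ?_⟩ <;> simp only [rawPtrVec, Matrix.cons_val_zero,
    Matrix.cons_val_one] <;> rw [div_le_one hp] <;> linarith

lemma ptr_tracks {k : ℕ} (hk : 0 < k) (hc : 2 * B + 13 + l = k ^ 2)
    (hs : ∀ i p, (s i p).Small) (hm : ∀ i p, (s i p).rawPtr = rawPtrVec p)
    (hs' : ∀ i p, ((s i p).ptr = 0 ∧ s' i p = { s i p with ptr := dir (p : ℕ) }) ∨
      ((∃ v : ℝ, 0 ≤ v ∧ (s i p).ptr = dir v) ∧ s' i p = s i p)) :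
    Tracks (fun rd _ x => (liftFeedforward E EJ rawPtrMask ptrInner (ptrOuter k)).apply norm rd x)
      (cellStream F E s) (cellStream F E s') := by
  have hk' : (0 : ℝ) < k := by exact_mod_cast hk
  have hsum : ∀ i (p : Fin (N i)), ∑ b : Slot B l, ((rawPtrMask b : ℝ) * (s i p).vec F b) ^ 2
      = (s i p).ptr 0 ^ 2 + (s i p).ptr 1 ^ 2 + (rawPtrVec p 0 ^ 2 + rawPtrVec p 1 ^ 2) :=
    fun i p => by simp [Slot.sum_eq, rawPtrMask, Cell.vec, hm]
  refine liftFeedforward_tracks E EJ norm (bddState_vec F hs) (c₀ := 1 / 2) (by norm_num)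
    (fun i p => ?_) fun i p a => ?_
  · rw [hsum]
    nlinarith [rawPtrVec_lower p, sq_nonneg ((s i p).ptr 0), sq_nonneg ((s i p).ptr 1)]
  have hp : (0 : ℝ) < ((p : ℕ) : ℝ) + 1 := by positivity
  obtain ⟨r, hr0, hr⟩ : ∃ r : ℝ, 0 ≤ r ∧ (s i p).ptr 0 ^ 2 + (s i p).ptr 1 ^ 2 +
      (rawPtrVec p 0 ^ 2 + rawPtrVec p 1 ^ 2) = r ^ 2 :=
    ⟨_, Real.sqrt_nonneg _, (Real.sq_sqrt (by positivity)).symm⟩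
  have hin : ∀ c, ∑ b : Slot B l, (ptrInner (.inr (.rawPtr c)) b : ℝ) *
      unitize rawPtrMask ((s i p).vec F) b
      = (rawPtrVec p c - ((s i p).ptr 0 + (s i p).ptr 1)) * k / r := by
    simp only [unitize_eq hk hc hr0 ((hsum i p).trans hr)]
    refine forall_fin_two.2 ⟨?_, ?_⟩ <;>
    simp [Slot.sum_eq, rawPtrMask, Cell.vec, hm, ptrInner] <;> ring
  have hout : ∀ (g : Hidden B l → ℝ) (c : Fin 2), ∑ j, (ptrOuter k (.ptr c) j : ℝ) * g j
      = 1 / k * g (.inr (.rawPtr c)) := fun g => by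
    refine forall_fin_two.2 ⟨?_, ?_⟩ <;> simp [Slot.sum_eq, ptrOuter]
  cases a with
  | ptr c =>
    rw [hout fun j => max 0 (∑ b : Slot B l, (ptrInner j b : ℝ) *
      unitize rawPtrMask ((s i p).vec F) b), hin]
    rcases hs' i p with ⟨h0, h1⟩ | ⟨⟨v, hv, h0⟩, h1⟩
    · rw [h0, rawPtrVec_sq] at hr
      have hr' : r = √(1 + ((p : ℕ) : ℝ) ^ 2) / ((p : ℕ) + 1) := by
        rw [← sq_eq_sq₀ hr0 (by positivity), ← hr]
        simp
      have hq : 0 < √(1 + ((p : ℕ) : ℝ) ^ 2) := by positivity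
      rw [h1, hr']
      revert c
      refine forall_fin_two.2 ⟨?_, ?_⟩ <;>
      simp [Cell.vec, h0, rawPtrVec, dir] <;>
      rw [max_eq_right (by positivity)] <;> field_simp
    -- The pointer is set already: the gate makes the input of the ReLU nonpositive.
    · rw [h1, h0, max_eq_left]
      · simp
      · refine div_nonpos_of_nonpos_of_nonneg (mul_nonpos_of_nonpos_of_nonneg ?_ hk'.le) hr0
        linarith [rawPtrVec_le p c, one_le_dir_add hv]
  | _ => rcases hs' i p with ⟨-, h1⟩ | ⟨-, h1⟩ <;> simp [h1, Cell.vec, ptrOuter]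

/-- The unit vectors that the main sublayers assume. -/
structure Cell.Unit (s : Cell B) : Prop where
  ptr : s.ptr 0 ^ 2 + s.ptr 1 ^ 2 = 1
  recvPtr : s.recvPtr 0 ^ 2 + s.recvPtr 1 ^ 2 = 1
  key : s.key 0 ^ 2 + s.key 1 ^ 2 = 1
  mark : s.mark 0 ^ 2 + s.mark 1 ^ 2 = 1

lemma sum_mainMask {k : ℕ} (hc : 2 * B + 13 + l = k ^ 2) {s : Cell B} (hs : s.Unit) :
    ∑ b : Slot B l, ((mainMask b : ℝ) * s.vec F b) ^ 2 = (k : ℝ) ^ 2 := by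
  have hb : ∀ b, (sign b : ℝ) ^ 2 = 1 := fun b => by rw [pow_two, sign_mul_self]
  have : ((k ^ 2 : ℕ) : ℝ) = 2 * B + 13 + l := by rw [← hc]; push_cast; ring
  rw [← Nat.cast_pow, this]
  simp [Slot.sum_eq, mainMask, Cell.vec, hb, mul_pow]
  linear_combination 4 * hs.ptr + 4 * hs.recvPtr + 4 * hs.key + hs.mark

lemma unitize_mainMask {k : ℕ} (hk : 0 < k) (hc : 2 * B + 13 + l = k ^ 2) {s : Cell B}
    (hs : s.Unit) (b : Slot B l) : unitize mainMask (s.vec F) b = mainMask b * s.vec F b := by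
  have hk' : (0 : ℝ) < k := by exact_mod_cast hk
  rw [unitize_eq hk hc hk'.le (sum_mainMask F hc hs), mul_div_cancel_right₀ _ hk'.ne']

lemma retrieve_tracks {k : ℕ} (hk : 0 < k) (hc : 2 * B + 13 + l = k ^ 2)
    (hs : ∀ i p, (s i p).Small) (hu : ∀ i p, (s i p).Unit) {target : ∀ i, Fin (N i) → ℕ}
    (htarget : ∀ i p, target i p ≤ p + 1) (hptr : ∀ i p, (s i p).ptr = dir (target i p : ℕ))
    (hkey : ∀ i p, (s i p).key = dir ((p : ℕ) + 1))
    (hrecv : ∀ i p, (s i p).recv = fun _ => true) (hrecvPtr : ∀ i p, (s i p).recvPtr = ![1, 0])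
    (sel : ∀ i, Fin (N i) → Fin (N i)) (hsel : ∀ i p, (sel i p : ℕ) = target i p - 1)
    (hs' : ∀ i p, s' i p = { s i p with
      recv := (s i (sel i p)).bit
      recvPtr := (s i (sel i p)).ptr }) :
    Tracks (fun rd _ x => (liftAttention E mainMask mainQuery mainKey mainValue).apply norm rd x)
      (cellStream F E s) (cellStream F E s') := by
  have hk' : (0 : ℝ) < k := by exact_mod_cast hk
  refine liftAttention_tracks_select E norm (bddState_vec F hs) (c₀ := (k : ℝ) ^ 2) (by positivity)
    (fun i p => (sum_mainMask F hc (hu i p)).ge) sel (fun i p => ?_) (γ := 1 / 8) (by norm_num)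
    -- The factor 4 comes from the mask weight 2 on pointer and key.
    (score := fun i p j => 4 * dot (dir (target i p : ℕ)) (dir ((j : ℕ) + 1)))
    (fun i p j => ?_) (fun i p j hj hne => ?_) fun i p a => ?_
  · have := htarget i p
    have := hsel i p
    rw [Fin.le_def]
    omega
  · simp only [unitize_mainMask F hk hc (hu _ _), Slot.sum_eq]
    simp [mainQuery, mainKey, mainMask, Cell.vec, hptr, hkey, dot]
    ring
  · have h1 := htarget i p
    have h2 := hsel i p
    have h3 : (j : ℕ) ≤ p := hj
    have h4 : (j : ℕ) ≠ sel i p := fun h => hne (Fin.ext h)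
    have h5 := p.2
    have key := dot_dir_gap (u := target i p) (t := j + 1) (N := N i) (by omega) (by omega)
      (by omega) (by omega)
    have h6 : max (target i p) 1 = sel i p + 1 := by omega
    rw [h6] at key
    push_cast at key
    have : 0 ≤ 1 / 8 / (N i : ℝ) ^ 4 := by positivity
    linarith
  · simp only [unitize_mainMask F hk hc (hu _ _), Slot.sum_eq, hs']
    cases a with
    | recv a =>
      have h1 : sign true = 1 := rfl
      simp [mainValue, mainMask, Cell.vec, hrecv, h1, apply_ite (Rat.cast : ℚ → ℝ)]
    | recvPtr c =>
      revert c
      refine forall_fin_two.2 ⟨?_, ?_⟩ <;>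
      simp [mainValue, mainMask, Cell.vec, hrecvPtr]
    | _ => simp [mainValue, Cell.vec]

/-- Every disagreement lowers the correlation of two sign vectors by 2. -/
lemma sum_sign_le (x y : Fin B → Bool) :
    ∑ a, (sign (x a) : ℝ) * sign (y a) ≤ B ∧
      (x ≠ y → ∑ a, (sign (x a) : ℝ) * sign (y a) ≤ B - 2) := by
  have h1 : ∀ a b : Bool, (sign a : ℝ) * sign b ≤ 1 := by
    intro a b; cases a <;> cases b <;> norm_num [sign]
  have hB : (B : ℝ) = ∑ _a : Fin B, (1 : ℝ) := by simp
  refine ⟨?_, fun hne => ?_⟩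
  · rw [hB]
    exact Finset.sum_le_sum fun a _ => h1 _ _
  · obtain ⟨a, ha⟩ := Function.ne_iff.1 hne
    have h2 : (sign (x a) : ℝ) * sign (y a) = -1 := by
      revert ha
      cases x a <;> cases y a <;> norm_num [sign]
    have : ∑ b, (sign (x b) : ℝ) * sign (y b)
        ≤ ∑ b, (1 - if b = a then (2 : ℝ) else 0) := Finset.sum_le_sum fun b _ => by
      split_ifs with h
      · rw [h, h2]; norm_num
      · simpa using h1 _ _
    refine this.trans (le_of_eq ?_)
    simp [Finset.sum_sub_distrib]

lemma sum_sign_self (x : Fin B → Bool) : ∑ a, (sign (x a) : ℝ) * sign (x a) = B := by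
  simp [sign_mul_self]

/-- Exactly one entry of the lookup table is active. -/
lemma lookup_unit (x y r b : Fin B → Bool) :
    max 0 (∑ a, (sign (y a) : ℝ) * sign (b a) + ∑ a, (sign (x a) : ℝ) * sign (r a)
      + (1 - 2 * (B : ℝ))) = if (x, y) = (r, b) then 1 else 0 := by
  have e1 := sum_sign_le x r
  have e2 := sum_sign_le y b
  split_ifs with h
  · obtain ⟨rfl, rfl⟩ := Prod.mk.inj h
    rw [sum_sign_self, sum_sign_self, max_eq_right] <;> linarith
  -- A mismatch in either half leaves a correlation of at most 2B - 2, hence at most -1 after the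
  -- threshold.
  · refine max_eq_left ?_
    by_cases hx : x = r
    · have := e2.2 fun hy => h (by rw [hx, hy])
      linarith [e1.1]
    · linarith [e1.2 hx, e2.1]

/-- Exactly one table unit fires, with value 1, so its outgoing column replaces bits and verdict at
once. Nonnegativity of the plane vectors lets the ReLU copy them. -/
lemma combine_tracks {k : ℕ} (hk : 0 < k) (hc : 2 * B + 13 + l = k ^ 2)
    (hs : ∀ i p, (s i p).Small) (hu : ∀ i p, (s i p).Unit) (hmark : ∀ i p, (s i p).mark = markVec p)
    (hptr : ∀ i p c, 0 ≤ (s i p).ptr c) (hrecvPtr : ∀ i p c, 0 ≤ (s i p).recvPtr c)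
    (hkey : ∀ i p c, 0 ≤ (s i p).key c)
    (hs' : ∀ i p, s' i p = { s i p with
      bit := op (s i p).recv (s i p).bit
      recv := fun _ => true
      ptr := (s i p).recvPtr
      recvPtr := ![1, 0]
      key := 0 }) :
    Tracks (fun rd _ x => (liftFeedforward E EJ mainMask mainInner (mainOuter F op)).apply norm rd x)
      (cellStream F E s) (cellStream F E s') := by
  have hk' : (0 : ℝ) < k := by exact_mod_cast hk
  refine liftFeedforward_tracks E EJ norm (bddState_vec F hs) (c₀ := (k : ℝ) ^ 2) (by positivity)
    (fun i p => (sum_mainMask F hc (hu i p)).ge) fun i p a => ?_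
  have hmk : ∀ c, 0 ≤ (markVec p : Fin 2 → ℝ) c :=
    forall_fin_two.2 ⟨by unfold markVec; split_ifs <;> simp, by unfold markVec; split_ifs <;> simp⟩
  have hl : ∀ q : (Fin B → Bool) × (Fin B → Bool), max 0 (∑ b : Slot B l,
      (mainInner (.inl q) b : ℝ) * (mainMask b * (s i p).vec F b))
      = if q = ((s i p).recv, (s i p).bit) then 1 else 0 := fun q => by
    rw [← lookup_unit]
    congr 1
    simp [Slot.sum_eq, mainInner, mainMask, Cell.vec, hmark]
    linear_combination (1 - 2 * (B : ℝ)) * markVec_add p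
  simp only [unitize_mainMask F hk hc (hu _ _), hs', sum_hidden, hl, mul_ite, mul_one, mul_zero,
    Finset.sum_ite_eq', Finset.mem_univ, if_true]
  have P0 := hptr i p 0
  have P1 := hptr i p 1
  have Q0 := hrecvPtr i p 0
  have Q1 := hrecvPtr i p 1
  have K0 := hkey i p 0
  have K1 := hkey i p 1
  have m0 := hmk 0
  have m1 := hmk 1
  have madd := markVec_add p
  cases a with
  | bit a => simp [Slot.sum_eq, mainOuter, Cell.vec]
  | recv a => simp [Slot.sum_eq, mainOuter, Cell.vec, sign]
  | verdict => simp [Slot.sum_eq, mainOuter, Cell.vec]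
  | ptr c =>
    revert c
    refine forall_fin_two.2 ⟨?_, ?_⟩ <;>
    simp [Slot.sum_eq, mainOuter, mainInner, mainMask, Cell.vec, P0, P1, Q0, Q1] <;> ring
  | recvPtr c =>
    revert c
    refine forall_fin_two.2 ⟨?_, ?_⟩ <;>
    simp [Slot.sum_eq, mainOuter, mainInner, mainMask, Cell.vec, hmark, P0, P1, Q0, Q1, m0, m1] <;>
    linarith
  | key c =>
    revert c
    refine forall_fin_two.2 ⟨?_, ?_⟩ <;>
    simp [Slot.sum_eq, mainOuter, mainInner, mainMask, Cell.vec, K0, K1] <;> ring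
  | _ => simp [Slot.sum_eq, mainOuter, Cell.vec]

end Sublayers

/-! ### The transformer -/

section Construction

variable {B l : ℕ} (F : (Fin B → Bool) → Bool)
  (op : (Fin B → Bool) → (Fin B → Bool) → Fin B → Bool)
  {m w : ℕ} (E : Slot B l × Bool ≃ Fin m) (EJ : Hidden B l ≃ Fin w) (k : ℕ)

def zeroAttention (m : ℕ) : Attention m 1 m := ⟨0, 0, 0, 0, 0⟩

def zeroFeedforward (m w : ℕ) : Feedforward m w := ⟨0, 0, 0⟩

def layerKey : Layer m 1 m w :=
  ⟨liftAttention E markMask (fun _ _ => 0) (fun _ _ => 0) (averageValue k 1),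
    liftFeedforward E EJ rawKeyMask keyInner (keyOuter k)⟩

def layerPtr : Layer m 1 m w :=
  ⟨zeroAttention m, liftFeedforward E EJ rawPtrMask ptrInner (ptrOuter k)⟩

def layerClear (w : ℕ) : Layer m 1 m w :=
  ⟨liftAttention E markMask (fun _ _ => 0) (fun _ _ => 0) (averageValue k (-1)),
    zeroFeedforward m w⟩

def layerCombine : Layer m 1 m w :=
  ⟨liftAttention E mainMask mainQuery mainKey mainValue,
    liftFeedforward E EJ mainMask mainInner (mainOuter F op)⟩

def layerZero (m w : ℕ) : Layer m 1 m w := ⟨zeroAttention m, zeroFeedforward m w⟩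

/-- Four layers perform a round; the others only add zero and bring the count to 8. -/
def block : Fin 8 → Layer m 1 m w :=
  ![layerKey E EJ k, layerPtr E EJ k, layerClear E k w, layerCombine F op E EJ, layerZero m w,
    layerZero m w, layerZero m w, layerZero m w]

def lastBlock : Fin 9 → Layer m 1 m w :=
  ![layerKey E EJ k, layerPtr E EJ k, layerClear E k w, layerCombine F op E EJ, layerZero m w,
    layerZero m w, layerZero m w, layerZero m w, layerZero m w]

/-! ### Embedding, unembedding and windows of the input -/

variable {α : Type u} (φ : List α → Fin B → Bool)

/-- `BoS` and `$` carry the empty word, so they are neutral under concatenation. -/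
def Token.word : Token α → List α
  | .letter a => [a]
  | _ => []

/-- The initial contents of the residual stream. -/
def embedSlot (t : Token α) : Slot B l → ℚ
  | .bit a => sign (φ t.word a)
  | .recv _ => 1
  | .recvPtr c => if c = 0 then 1 else 0
  | .mark c => match t with
    | .bos => if c = 0 then 1 else 0
    | _ => if c = 0 then 0 else 1
  | .verdict => sign (F (φ t.word))
  | .pad _ => 1
  | _ => 0

def tokenClass : Token α → Fin 3
  | .eos => 0
  | .bos => 1
  | .letter _ => 2

/-- The `mark` coordinates sum to 1, so letters get the constant logit -3, and the verdict decides
between `$`, which means accept, and `BoS`. -/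
def unembedSlot : Fin 3 → Slot B l → ℚ
  | 0, .verdict => 1
  | 1, .verdict => -1
  | 2, .mark _ => -3
  | _, _ => 0

def unembedClass : Matrix (Fin 3) (Fin m) ℚ :=
  fun i a => if (E.symm a).2 then unembedSlot i (E.symm a).1 else 0

def transformer : UniversalTransformer (Token α) 0 8 9 m w where
  heads := 1
  headDim := m
  dim_eq := one_mul m
  embed t a := if (E.symm a).2 then embedSlot F φ t (E.symm a).1
    else -embedSlot F φ t (E.symm a).1
  initial := Fin.elim0
  repeated := block F op E EJ k
  final := lastBlock F op E EJ k
  unembed t := unembedClass E (tokenClass t)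
  accept := .eos

/-- The window of (up to) `2 ^ j` letters that ends at position `p`. -/
def window (x : List α) (j p : ℕ) : List α := (x.take p).drop (p - 2 ^ j)

/-- Truncated subtraction handles the left end: for p ≤ 2^j the left window sits at position 0 and
is empty. -/
lemma window_append (x : List α) (j p : ℕ) :
    window x j (p - 2 ^ j) ++ window x j p = window x (j + 1) p := by
  have h1 : p - 2 ^ j - 2 ^ j = p - 2 ^ (j + 1) := by rw [pow_succ]; omega
  have h2 : x.take (p - 2 ^ j) = (x.take p).take (p - 2 ^ j) := by
    rw [List.take_take, min_eq_left (Nat.sub_le _ _)]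
  have h3 : p - 2 ^ (j + 1) ≤ p - 2 ^ j := by rw [pow_succ]; omega
  unfold window
  rw [h1, h2, List.drop_take]
  conv_rhs => rw [← List.take_append_drop (p - 2 ^ j - (p - 2 ^ (j + 1)))
    ((x.take p).drop (p - 2 ^ (j + 1))), List.drop_drop, Nat.add_sub_cancel' h3]

/-- The length of the prompt. -/
abbrev promptLength (i : List α × ℕ) : ℕ := i.1.length + 1 + 1

/-- The cell at position `p` before round `j`. -/
def roundCell (i : List α × ℕ) (p : Fin (promptLength i)) : Cell B where
  bit := φ (window i.1 i.2 p)
  recv _ := true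
  ptr := if i.2 = 0 then 0 else dir ((p + 1 - 2 ^ i.2 : ℕ) : ℝ)
  recvPtr := ![1, 0]
  key := 0
  rawKey := 0
  rawPtr := 0
  mark := markVec p

/-- The cell at position `p` after round `j`. -/
def nextCell (i : List α × ℕ) (p : Fin (promptLength i)) : Cell B := roundCell φ (i.1, i.2 + 1) p

/-! ### One round of doubling -/

variable (norm : NormKind)

/-- Running a list of layers. -/
def runLayers (Λ : List (Layer m 1 m w)) (rd : ℝ → ℝ) {n : ℕ} (x : Fin n → Fin m → ℝ) :
    Fin n → Fin m → ℝ :=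
  Λ.foldl (fun h Λ => Λ.apply norm rd h) x

variable {ι : Type*} {N : ι → ℕ}

lemma zero_tracks {s : ∀ i, Fin (N i) → Cell B} (hs : ∀ i p, (s i p).Small) :
    Tracks (fun rd _ x => (layerZero m w).apply norm rd x) (cellStream F E s)
      (cellStream F E s) :=
  have hb : BddStream (cellStream F E s) := (bddState_vec F hs).stream E
  ((zeroAttention m).tracks_of_out_eq_zero norm rfl hb).comp
    ((zeroFeedforward m w).tracks_of_outer_eq_zero norm rfl hb)

lemma abs_rawKeyVec_le (p : ℕ) : ∀ c, |rawKeyVec p c| ≤ 1 := by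
  have hp : (0 : ℝ) < (p : ℝ) + 1 := by positivity
  refine forall_fin_two.2 ⟨?_, by simp [rawKeyVec]⟩
  simp only [rawKeyVec, Matrix.cons_val_zero]
  rw [abs_of_nonneg (by positivity), div_le_one hp]
  linarith [(Nat.cast_nonneg p : (0 : ℝ) ≤ p)]

lemma abs_rawPtrVec_le (p : ℕ) (c : Fin 2) : |rawPtrVec p c| ≤ 1 := by
  rw [abs_of_nonneg]
  · exact rawPtrVec_le p c
  · revert c
    refine forall_fin_two.2 ⟨?_, ?_⟩ <;>
    simp only [rawPtrVec, Matrix.cons_val_zero, Matrix.cons_val_one] <;> positivity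

lemma abs_markVec_le {n : ℕ} (p : Fin n) : ∀ c, |markVec p c| ≤ 1 := by
  unfold markVec
  refine forall_fin_two.2 ⟨?_, ?_⟩ <;> split_ifs <;> simp

lemma abs_rest_le : ∀ c, |(![1, 0] : Fin 2 → ℝ) c| ≤ 1 := forall_fin_two.2 ⟨by simp, by simp⟩

lemma abs_zero_le (c : Fin 2) : |(0 : Fin 2 → ℝ) c| ≤ 1 := by simp

lemma roundCell_small (i : List α × ℕ) (p : Fin (promptLength i)) :
    (roundCell φ i p).Small where
  ptr := by
    unfold roundCell
    dsimp only
    split_ifs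
    · exact abs_zero_le
    · exact abs_dir_le _
  recvPtr := abs_rest_le
  key := abs_zero_le
  rawKey := abs_zero_le
  rawPtr := abs_zero_le
  mark := abs_markVec_le p

/-- An instance is a pair of a word and a round number, so one constant serves all words and all
rounds. The cells `c0` to `c5` are the ideal contents between sublayers. -/
lemma round_tracks (hk : 0 < k) (hc : 2 * B + 13 + l = k ^ 2)
    (hφ : ∀ u v, φ (u ++ v) = op (φ u) (φ v)) :
    Tracks (fun rd _ x => runLayers norm [layerKey E EJ k, layerPtr E EJ k, layerClear E k w,
        layerCombine F op E EJ] rd x)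
      (cellStream (N := promptLength) F E (roundCell φ))
      (cellStream (N := promptLength) F E (nextCell φ)) := by
  let c0 : ∀ i : List α × ℕ, Fin (promptLength i) → Cell B := roundCell φ
  let c1 : ∀ i : List α × ℕ, Fin (promptLength i) → Cell B := fun i p =>
    { c0 i p with rawKey := rawKeyVec p, rawPtr := rawPtrVec p }
  let c2 : ∀ i : List α × ℕ, Fin (promptLength i) → Cell B := fun i p =>
    { c1 i p with key := dir ((p : ℕ) + 1) }
  let c3 : ∀ i : List α × ℕ, Fin (promptLength i) → Cell B := fun i p =>
    { c2 i p with ptr := dir ((p + 1 - 2 ^ i.2 : ℕ) : ℝ) }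
  let c4 : ∀ i : List α × ℕ, Fin (promptLength i) → Cell B := fun i p =>
    { c3 i p with rawKey := 0, rawPtr := 0 }
  let sel : ∀ i : List α × ℕ, Fin (promptLength i) → Fin (promptLength i) := fun i p =>
    ⟨p - 2 ^ i.2, (Nat.sub_le _ _).trans_lt p.2⟩
  let c5 : ∀ i : List α × ℕ, Fin (promptLength i) → Cell B := fun i p =>
    { c4 i p with
      recv := (c4 i (sel i p)).bit
      recvPtr := (c4 i (sel i p)).ptr }
  have s0 : ∀ i p, (c0 i p).Small := roundCell_small φ
  have s1 : ∀ i p, (c1 i p).Small := fun i p =>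
    ⟨(s0 i p).ptr, abs_rest_le, abs_zero_le, abs_rawKeyVec_le p, abs_rawPtrVec_le p,
      abs_markVec_le p⟩
  have s2 : ∀ i p, (c2 i p).Small := fun i p =>
    ⟨(s0 i p).ptr, abs_rest_le, abs_dir_le _, abs_rawKeyVec_le p, abs_rawPtrVec_le p,
      abs_markVec_le p⟩
  have s3 : ∀ i p, (c3 i p).Small := fun i p =>
    ⟨abs_dir_le _, abs_rest_le, abs_dir_le _, abs_rawKeyVec_le p, abs_rawPtrVec_le p,
      abs_markVec_le p⟩
  have s4 : ∀ i p, (c4 i p).Small := fun i p =>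
    ⟨abs_dir_le _, abs_rest_le, abs_dir_le _, abs_zero_le, abs_zero_le, abs_markVec_le p⟩
  have s5 : ∀ i p, (c5 i p).Small := fun i p =>
    ⟨abs_dir_le _, abs_dir_le _, abs_dir_le _, abs_zero_le, abs_zero_le, abs_markVec_le p⟩
  have u4 : ∀ i p, (c4 i p).Unit := fun i p =>
    ⟨dir_sq _, by simp [c4, c3, c2, c1, c0, roundCell], dir_sq _, markVec_sq p⟩
  have u5 : ∀ i p, (c5 i p).Unit := fun i p => ⟨dir_sq _, dir_sq _, dir_sq _, markVec_sq p⟩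
  have t1 := average_tracks F E norm hk hc 1 s0 (s' := c1) (fun _ _ => rfl) (fun i p => by
    simp [c1, c0, roundCell])
  have t2 := key_tracks F E EJ norm hk hc s1 (s' := c2) (fun _ _ => rfl) (fun i p => by
    simp [c2, c1, c0, roundCell])
  have t3 := ptr_tracks F E EJ norm hk hc s2 (s' := c3) (fun _ _ => rfl) (fun i p => by
    rcases Nat.eq_zero_or_pos i.2 with h | h
    · left
      simp [c3, c2, c1, c0, roundCell, h]
    · right
      refine ⟨⟨((p + 1 - 2 ^ i.2 : ℕ) : ℝ), Nat.cast_nonneg _, ?_⟩, ?_⟩ <;>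
      simp [c3, c2, c1, c0, roundCell, h.ne'])
  have t4 := average_tracks F E norm hk hc (-1) s3 (s' := c4) (fun _ _ => rfl) (fun i p => by
    have h0 : (fun _ => 0 : Fin 2 → ℝ) = 0 := rfl
    simp [c4, c3, c2, c1, h0])
  have t5 := retrieve_tracks F E norm hk hc s4 u4 (s' := c5)
    (target := fun i p => p + 1 - 2 ^ i.2) (fun i p => Nat.sub_le _ _) (fun _ _ => rfl)
    (fun _ _ => rfl) (fun _ _ => rfl) (fun _ _ => rfl) sel (fun i p => by
      dsimp only [sel]
      omega) (fun _ _ => rfl)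
  have t6 := combine_tracks F op E EJ norm hk hc s5 u5
    (s' := nextCell φ) (fun _ _ => rfl)
    (fun i p => dir_nonneg (Nat.cast_nonneg _)) (fun i p => dir_nonneg (Nat.cast_nonneg _))
    (fun i p => dir_nonneg (v := (p : ℕ) + 1) (by positivity)) (fun i p => by
      have hw : φ (window i.1 (i.2 + 1) p)
          = op (φ (window i.1 i.2 (p - 2 ^ i.2))) (φ (window i.1 i.2 p)) := by
        rw [← hφ, window_append]
      -- Pointer doubling: the pointer found at the fetched position is the next pointer of `p`. For
      -- p < 2^j both sides are 0.
      have hp : p - 2 ^ i.2 + 1 - 2 ^ i.2 = (p : ℕ) + 1 - 2 ^ (i.2 + 1) := by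
        have := Nat.one_le_two_pow (n := i.2)
        rw [pow_succ]
        omega
      simp [c5, c4, c3, c2, c1, c0, nextCell, roundCell, hw, sel, hp])
  have z2 := (zeroAttention m).tracks_of_out_eq_zero norm rfl ((bddState_vec F s2).stream E)
  have z4 := (zeroFeedforward m w).tracks_of_outer_eq_zero norm rfl ((bddState_vec F s4).stream E)
  exact (((((((t1.comp t2).comp z2).comp t3).comp t4).comp z4).comp t5).comp t6)

lemma block_tracks (hk : 0 < k) (hc : 2 * B + 13 + l = k ^ 2)
    (hφ : ∀ u v, φ (u ++ v) = op (φ u) (φ v)) :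
    Tracks (fun rd _ x => runLayers norm (List.ofFn (block F op E EJ k)) rd x)
      (cellStream (N := promptLength) F E (roundCell φ))
      (cellStream (N := promptLength) F E (nextCell φ)) := by
  have z : Tracks (fun rd _ x => (layerZero m w).apply norm rd x) _ _ :=
    zero_tracks (N := promptLength) F E norm fun i => roundCell_small φ (i.1, i.2 + 1)
  exact ((((round_tracks F op E EJ k φ norm hk hc hφ).comp z).comp z).comp z).comp z

lemma lastBlock_tracks (hk : 0 < k) (hc : 2 * B + 13 + l = k ^ 2)
    (hφ : ∀ u v, φ (u ++ v) = op (φ u) (φ v)) :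
    Tracks (fun rd _ x => runLayers norm (List.ofFn (lastBlock F op E EJ k)) rd x)
      (cellStream (N := promptLength) F E (roundCell φ))
      (cellStream (N := promptLength) F E (nextCell φ)) := by
  have z : Tracks (fun rd _ x => (layerZero m w).apply norm rd x) _ _ :=
    zero_tracks (N := promptLength) F E norm fun i => roundCell_small φ (i.1, i.2 + 1)
  exact (block_tracks F op E EJ k φ norm hk hc hφ).comp z

end Construction

/-! ### Rounding in an accurate datatype -/

/-- There are finitely many bit strings, so the supremum in `Datatype.round` is attained at a
nearest value. -/
lemma Datatype.round_spec (D : Datatype) (p : ℕ) (x : ℝ) {y : ℝ} (hy : y ∈ Set.range (D.val p)) :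
    |x - D.round p x| ≤ |x - y| := by
  have hfin : (Set.range (D.val p)).Finite := Set.finite_range _
  obtain ⟨y₀, hy₀, hmin⟩ := hfin.exists_minimalFor (fun y => |x - y|) _ (Set.range_nonempty _)
  have hmem := Set.Nonempty.csSup_mem (s := {y : ℝ | y ∈ Set.range (D.val p) ∧
    ∀ z ∈ Set.range (D.val p), |x - y| ≤ |x - z|})
    ⟨y₀, hy₀, fun z hz => by
      rcases le_total (|x - y₀|) (|x - z|) with h | h
      · exact h
      · exact hmin hz h⟩
    (hfin.subset fun y hy => hy.1)
  exact hmem.2 y hy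

lemma Datatype.Accurate.round_close {D : Datatype} (hD : D.Accurate) :
    ∃ ε : ℝ, 0 < ε ∧ ∃ p₀ : ℕ, ∀ p ≥ p₀, D.round p 0 = 0 ∧
      ∀ x : ℝ, |x| ≤ (2 : ℝ) ^ (ε * (p : ℝ)) →
        |D.round p x - x| ≤ (2 : ℝ) ^ (-(ε * (p : ℝ))) := by
  obtain ⟨ε, hε, h⟩ := hD
  obtain ⟨p₀, hp⟩ := eventually_atTop.1 h
  refine ⟨ε, hε, p₀, fun p hpp => ⟨?_, fun x hx => ?_⟩⟩
  · have := D.round_spec p 0 (hp p hpp).1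
    simpa using this
  · obtain ⟨y, hy, hxy⟩ := (hp p hpp).2 x hx
    rw [abs_sub_comm]
    exact (D.round_spec p x hy).trans hxy

lemma logDepth_le (n : ℕ) : (logDepth n : ℝ) ≤ Real.logb 2 ((n : ℝ) + 2) + 1 := by
  have h1 : 0 ≤ Real.logb 2 (n : ℝ) := by
    rcases Nat.eq_zero_or_pos n with rfl | h
    · simp
    · exact Real.logb_nonneg one_lt_two (by exact_mod_cast h)
  have h2 : Real.logb 2 (n : ℝ) ≤ Real.logb 2 ((n : ℝ) + 2) := by
    rcases Nat.eq_zero_or_pos n with rfl | h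
    · simp
    · exact Real.logb_le_logb_of_le one_lt_two (by exact_mod_cast h) (by linarith)
  have := Nat.ceil_lt_add_one h1
  rw [logDepth]
  linarith

lemma le_two_pow_logDepth {n : ℕ} (hn : 1 ≤ n) : n ≤ 2 ^ logDepth n := by
  have h0 : (0 : ℝ) < n := by exact_mod_cast hn
  have h1 : Real.logb 2 (n : ℝ) ≤ (logDepth n : ℝ) := Nat.le_ceil _
  rw [Real.logb_le_iff_le_rpow one_lt_two h0, Real.rpow_natCast] at h1
  exact_mod_cast h1

/-- Logarithmic precision suffices for any fixed power of a constant per layer. -/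
lemma exists_precision {C ε : ℝ} (hC : 1 ≤ C) (hε : 0 < ε) (p₀ : ℕ) :
    ∃ c : ℝ, 0 < c ∧ ∀ n p : ℕ, c * Real.logb 2 ((n : ℝ) + 2) ≤ p → p₀ ≤ p ∧
      C ^ (logDepth n + 3) * ((n : ℝ) + 2) ^ 5 ≤ (2 : ℝ) ^ (ε * (p : ℝ)) := by
  obtain ⟨s, hs⟩ := pow_unbounded_of_one_lt C one_lt_two
  -- `5 * s` pays for C^(d+3), since C < 2^s and d + 3 ≤ L + 4 ≤ 5L; the other 5 pays for the fifth
  -- power, and `p₀` suffices as L ≥ 1.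
  refine ⟨(5 * s + 5) / ε + p₀, by positivity, fun n p hp => ?_⟩
  set L := Real.logb 2 ((n : ℝ) + 2) with hL
  have hn : (2 : ℝ) ≤ (n : ℝ) + 2 := by linarith [(Nat.cast_nonneg n : (0 : ℝ) ≤ n)]
  have hL1 : 1 ≤ L := by
    rw [hL, Real.le_logb_iff_rpow_le one_lt_two (by linarith), Real.rpow_one]
    exact hn
  have hq : 0 ≤ (5 * s + 5) / ε := by positivity
  have hp0 : (0 : ℝ) ≤ p₀ := by positivity
  constructor
  · have : (p₀ : ℝ) ≤ p := by nlinarith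
    exact_mod_cast this
  · have h1 : (5 * s + 5) * L ≤ ε * p := by
      have : (5 * s + 5) / ε * L ≤ p := by nlinarith
      rw [div_mul_eq_mul_div, div_le_iff₀ hε] at this
      linarith
    have h2 : ((n : ℝ) + 2) ^ 5 = (2 : ℝ) ^ (5 * L) := by
      rw [mul_comm, Real.rpow_mul two_pos.le, hL, Real.rpow_logb two_pos (by norm_num) (by linarith)]
      norm_cast
    have h3 : C ^ (logDepth n + 3) ≤ (2 : ℝ) ^ (5 * s * L) := by
      calc C ^ (logDepth n + 3) ≤ ((2 : ℝ) ^ s) ^ (logDepth n + 3) := by gcongr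
        _ = (2 : ℝ) ^ ((s * (logDepth n + 3) : ℕ) : ℝ) := by rw [Real.rpow_natCast, pow_mul]
        _ ≤ (2 : ℝ) ^ (5 * s * L) := by
          refine Real.rpow_le_rpow_of_exponent_le one_le_two ?_
          push_cast
          have : (logDepth n : ℝ) + 3 ≤ 5 * L := by linarith [logDepth_le n]
          calc (s : ℝ) * (logDepth n + 3) ≤ s * (5 * L) := by gcongr
            _ = _ := by ring
    calc C ^ (logDepth n + 3) * ((n : ℝ) + 2) ^ 5
        ≤ (2 : ℝ) ^ (5 * s * L) * (2 : ℝ) ^ (5 * L) := by rw [h2]; gcongr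
      _ = (2 : ℝ) ^ ((5 * s + 5) * L) := by rw [← Real.rpow_add two_pos]; ring_nf
      _ ≤ _ := Real.rpow_le_rpow_of_exponent_le one_le_two h1

/-! ### Correctness -/

section Correctness

variable {B l : ℕ} (F : (Fin B → Bool) → Bool)
  (op : (Fin B → Bool) → (Fin B → Bool) → Fin B → Bool)
  {m w : ℕ} (E : Slot B l × Bool ≃ Fin m) (EJ : Hidden B l ≃ Fin w) (k : ℕ)
  {α : Type u} (φ : List α → Fin B → Bool) (norm : NormKind)

lemma prompt_zero (x : List α) : prompt x 0 = Token.bos := rfl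

lemma prompt_succ (x : List α) (i : Fin (x.length + 1)) :
    prompt x i.succ = Fin.snoc (α := fun _ => Token α) (fun i : Fin x.length =>
      Token.letter (x.get i)) Token.eos i := by
  simp [prompt]

lemma word_prompt (x : List α) (p : Fin (x.length + 1 + 1)) :
    (prompt x p).word = window x 0 p := by
  refine Fin.cases ?_ (fun i => ?_) p
  · simp [prompt_zero, Token.word, window]
  · rw [prompt_succ]
    refine Fin.lastCases ?_ (fun i => ?_) i
    · simp [Token.word, window]
    · have hi := i.2
      simp only [Fin.snoc_castSucc, Token.word, window, Fin.val_succ, Fin.val_castSucc, pow_zero,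
        Nat.add_sub_cancel, List.get_eq_getElem]
      rw [List.take_succ_eq_append_getElem hi, List.drop_append_of_le_length (by simp)]
      simp

lemma embedSlot_prompt (x : List α) (p : Fin (x.length + 1 + 1)) (t : Slot B l) :
    (embedSlot F φ (prompt x p) t : ℝ) = (roundCell φ (x, 0) p).vec F t := by
  have hw := word_prompt x p
  cases t with
  | bit a => simp [embedSlot, Cell.vec, roundCell, hw]
  | recv a => simp [embedSlot, Cell.vec, roundCell, sign]
  | recvPtr c =>
    revert c
    refine forall_fin_two.2 ⟨?_, ?_⟩ <;> simp [embedSlot, Cell.vec, roundCell]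
  | mark c =>
    simp only [Cell.vec, roundCell]
    revert c
    clear hw
    refine Fin.cases ?_ (fun i => ?_) p
    · refine forall_fin_two.2 ⟨?_, ?_⟩ <;> simp [embedSlot, prompt_zero, markVec]
    · have hne : prompt x i.succ ≠ Token.bos := by
        rw [prompt_succ]
        refine Fin.lastCases ?_ (fun i => ?_) i <;> simp
      generalize prompt x i.succ = t at hne
      refine forall_fin_two.2 ⟨?_, ?_⟩ <;> cases t <;> simp_all [embedSlot, markVec]
  | verdict => simp [embedSlot, Cell.vec, roundCell, hw]
  | _ => simp [embedSlot, Cell.vec, roundCell]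

/-- After `d` rounds the error has grown by a factor `C ^ d`. -/
lemma iterate_close {C : ℝ} (hC1 : 1 ≤ C)
    (hC : ∀ t : Run promptLength (cellStream F E (roundCell φ)), t.ctx.Good C → ∀ p a,
      |runLayers norm (List.ofFn (block F op E EJ k)) t.rd t.x p a
        - cellStream (N := promptLength) F E (nextCell φ) t.i p a| ≤ C * t.e)
    (x : List α) {rd : ℝ → ℝ} {e : ℝ} {X : Fin (x.length + 1 + 1) → Fin m → ℝ}
    (hX : ∀ p a, |X p a - lift E ((roundCell φ (x, 0) p).vec F) a| ≤ e) (d : ℕ)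
    (hg : Ctx.Good ⟨rd, x.length + 1 + 1, e⟩ (C ^ d)) :
    ∀ p a, |runLayers norm (List.replicate d (List.ofFn (block F op E EJ k))).flatten rd X p a
      - lift E ((roundCell φ (x, d) p).vec F) a| ≤ C ^ d * e := by
  induction d with
  | zero => simpa [runLayers] using hX
  | succ d ih =>
    have h1 : (1 : ℝ) ≤ C ^ d := one_le_pow₀ hC1
    have hd := ih (hg.mono (by rw [pow_succ]; nlinarith))
    intro p a
    rw [List.replicate_succ', List.flatten_append, runLayers, List.foldl_append]
    have := hC ⟨(x, d), rd, C ^ d * e, _, hd⟩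
      (Ctx.Good.scale (c := ⟨rd, x.length + 1 + 1, e⟩) (by rwa [pow_succ] at hg) h1 (by linarith)) p a
    refine le_trans (le_of_eq ?_) (this.trans (le_of_eq ?_))
    · simp [runLayers, cellStream, nextCell]
    · dsimp only
      ring

/-- The logits of the ideal residual stream. -/
def idealLogit (b : Bool) : Fin 3 → ℝ := ![sign b, -sign b, -3]

lemma unembed_approx : ∀ i, Approx
    (fun t : Run promptLength (cellStream (N := promptLength) F E (nextCell φ)) => t.ctx)
    (fun t => mulVecRd t.rd (unembedClass E) (t.x (Fin.last _)) i)
    (fun t => idealLogit (F (nextCell φ t.i (Fin.last _)).bit) i) := by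
  intro i
  have hb : BddState (N := promptLength) fun i p => ((nextCell φ i p).vec F : Slot B l → ℝ) :=
    bddState_vec (N := promptLength) F fun i => roundCell_small φ (i.1, i.2 + 1)
  have hb' := (hb.stream E).run
  let g : Run promptLength (cellStream (N := promptLength) F E (nextCell φ)) →
      Σ t : Run promptLength (cellStream (N := promptLength) F E (nextCell φ)),
        Fin (promptLength t.i) := fun t => ⟨t, Fin.last _⟩
  refine (Approx.mulVecRd (c := fun t : Run promptLength
    (cellStream (N := promptLength) F E (nextCell φ)) => t.ctx) (unembedClass E)
    (fun a => (Run.approx _ a).comp g) (fun a => (hb' a).comp g) i).congr fun t => ?_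
  have hmk := markVec_add (Fin.last (t.i.1.length + 1))
  have hs : ∀ f : Slot B l → ℝ, ∑ a, (unembedClass E i a : ℝ) * lift E f a
      = ∑ s, (unembedSlot i s : ℝ) * f s := fun f => by
    simp [sum_fin_eq E, lift, unembedClass]
  refine (hs _).trans ?_
  rw [Slot.sum_eq]
  fin_cases i <;> simp [unembedSlot, idealLogit, Cell.vec, g, nextCell, roundCell]
  linarith

/-- The best ideal logit is 1 and the others are at most -1, so errors of 1/2 are harmless. -/
lemma outputs_of_logits {x : List α} {rd : ℝ → ℝ} {d : ℕ} {b : Bool}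
    (h : ∀ v, |(transformer F op E EJ k φ).logits norm rd d (prompt x) v
      - idealLogit b (tokenClass v)| ≤ 1 / 2) :
    (transformer F op E EJ k φ).Outputs norm rd d (prompt x)
      (if b then Token.eos else Token.bos) := by
  intro v hv
  have h1 := abs_le.1 (h v)
  cases b
  · have h2 := abs_le.1 (h Token.bos)
    cases v <;> simp [idealLogit, tokenClass, sign] at h1 h2 hv ⊢ <;> linarith
  · have h2 := abs_le.1 (h Token.eos)
    cases v <;> simp [idealLogit, tokenClass, sign] at h1 h2 hv ⊢ <;> linarith

/-- One constant that bounds the growth of the error in all parts of the transformer. -/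
lemma exists_growth (hk : 0 < k) (hc : 2 * B + 13 + l = k ^ 2)
    (hφ : ∀ u v, φ (u ++ v) = op (φ u) (φ v)) :
    ∃ C : ℝ, 1 ≤ C ∧
      (∀ t : Run promptLength (cellStream F E (roundCell φ)), t.ctx.Good C → ∀ p a,
        |runLayers norm (List.ofFn (block F op E EJ k)) t.rd t.x p a
          - cellStream (N := promptLength) F E (nextCell φ) t.i p a| ≤ C * t.e) ∧
      (∀ t : Run promptLength (cellStream F E (roundCell φ)), t.ctx.Good C → ∀ p a,
        |runLayers norm (List.ofFn (lastBlock F op E EJ k)) t.rd t.x p a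
          - cellStream (N := promptLength) F E (nextCell φ) t.i p a| ≤ C * t.e) ∧
      ∀ i, ∀ t : Run promptLength (cellStream (N := promptLength) F E (nextCell φ)), t.ctx.Good C →
        |mulVecRd t.rd (unembedClass E) (t.x (Fin.last _)) i
          - idealLogit (F (nextCell φ t.i (Fin.last _)).bit) i| ≤ C * t.e := by
  obtain ⟨C₁, h1, hC₁⟩ := block_tracks F op E EJ k φ norm hk hc hφ
  obtain ⟨C₂, h2, hC₂⟩ := lastBlock_tracks F op E EJ k φ norm hk hc hφ
  choose C₃ h3 hC₃ using unembed_approx (l := l) F E φ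
  have hle : ∀ i, C₃ i ≤ C₃ 0 + C₃ 1 + C₃ 2 := by
    have g0 := h3 0
    have g1 := h3 1
    have g2 := h3 2
    intro i
    fin_cases i <;> simp <;> linarith
  have g := (h3 0).trans (hle 0)
  refine ⟨C₁ + C₂ + (C₃ 0 + C₃ 1 + C₃ 2), by linarith, fun t ht q a => ?_, fun t ht q a => ?_,
    fun i t ht => ?_⟩ <;> have he : 0 < t.e := ht.e_pos
  · exact (hC₁ t (ht.mono (by linarith)) q a).trans (by gcongr; linarith)
  · exact (hC₂ t (ht.mono (by linarith)) q a).trans (by gcongr; linarith)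
  · exact (hC₃ i t (ht.mono (by linarith [hle i]))).trans
      (mul_le_mul_of_nonneg_right (by linarith [hle i]) he.le)

lemma runLayers_append (Λ Λ' : List (Layer m 1 m w)) (rd : ℝ → ℝ) {n : ℕ}
    (x : Fin n → Fin m → ℝ) :
    runLayers norm (Λ ++ Λ') rd x = runLayers norm Λ' rd (runLayers norm Λ rd x) :=
  List.foldl_append

lemma transformer_logits (x : List α) (rd : ℝ → ℝ) (d : ℕ) (v : Token α) :
    (transformer F op E EJ k φ).logits norm rd d (prompt x) v
      = mulVecRd rd (unembedClass E) (runLayers norm (List.ofFn (lastBlock F op E EJ k)) rd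
        (runLayers norm (List.replicate d (List.ofFn (block F op E EJ k))).flatten rd
          fun q a => rd ((transformer F op E EJ k φ).embed (prompt x q) a : ℝ)) (Fin.last _))
        (tokenClass v) := by
  rw [← runLayers_append]
  rfl

lemma transformer_recognizes (hk : 0 < k) (hc : 2 * B + 13 + l = k ^ 2)
    (hφ : ∀ u v, φ (u ++ v) = op (φ u) (φ v)) {L : Language α}
    (hL : ∀ x, x ∈ L ↔ F (φ x) = true) :
    (transformer F op E EJ k φ).Recognizes norm logDepth L := by
  obtain ⟨C, hC1, hC₁, hC₂, hC₃⟩ := exists_growth F op E EJ k φ norm hk hc hφ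
  intro D hD
  obtain ⟨ε, hε, p₀, hround⟩ := hD.round_close
  -- The power (2C)^(d+3) covers C^d for the rounds, C for the last block and 2C for the
  -- unembedding, where the 2 brings the final error down to 1/2.
  obtain ⟨c, hc0, hp⟩ := exists_precision (C := 2 * C) (by linarith) hε p₀
  refine ⟨c, hc0, fun x p hpx => ?_⟩
  obtain ⟨hp0, hprec⟩ := hp x.length p hpx
  obtain ⟨hr0, hrd⟩ := hround p hp0
  set rd := D.round p
  set d := logDepth x.length with hd
  set M : ℝ := (2 : ℝ) ^ (ε * (p : ℝ)) with hM
  have hM0 : 0 < M := by positivity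
  rw [Real.rpow_neg two_pos.le, ← hM] at hrd
  set n : ℝ := (x.length : ℝ) + 2 with hn
  have hn2 : 2 ≤ n := by
    rw [hn]
    linarith [(Nat.cast_nonneg x.length : (0 : ℝ) ≤ x.length)]
  have hncast : ((x.length + 1 + 1 : ℕ) : ℝ) = n := by
    rw [hn]
    push_cast
    ring
  have hA1 : 1 ≤ (2 * C) ^ (d + 3) := one_le_pow₀ (by linarith)
  have hpow : n ≤ n ^ 5 := le_self_pow₀ (by linarith) (by norm_num)
  -- The initial error is n times the rounding error, as `Good.close` requires; with the fourth
  -- power in `Good.small` this makes n^5.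
  have hgood : Ctx.Good ⟨rd, x.length + 1 + 1, n * M⁻¹⟩ ((2 * C) ^ (d + 3)) := by
    refine ⟨hr0, by positivity, by simp, ?_, fun y hy => ?_⟩
    · dsimp only
      rw [hncast]
      calc (2 * C) ^ (d + 3) * n ^ 4 * (n * M⁻¹) = (2 * C) ^ (d + 3) * n ^ 5 * M⁻¹ := by ring
        _ ≤ M * M⁻¹ := by gcongr
        _ = 1 := mul_inv_cancel₀ hM0.ne'
    · dsimp only at hy ⊢
      rw [hncast] at hy ⊢
      gcongr
      refine hrd y (hy.trans (le_trans ?_ hprec))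
      gcongr
  have hM1 : 1 ≤ M := by nlinarith
  have hinit : ∀ q a, |rd ((transformer F op E EJ k φ).embed (prompt x q) a : ℝ)
      - lift E ((roundCell φ (x, 0) q).vec F) a| ≤ n * M⁻¹ := fun q a => by
    have he : ((transformer F op E EJ k φ).embed (prompt x q) a : ℝ)
        = lift E ((roundCell φ (x, 0) q).vec F) a := by
      simp only [transformer, lift, ← embedSlot_prompt]
      split_ifs <;> simp
    have hle : |lift E ((roundCell φ (x, 0) q).vec F) a| ≤ 1 := by
      unfold lift
      split_ifs
      · exact (roundCell_small φ (x, 0) q).abs_vec_le F _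
      · rw [abs_neg]
        exact (roundCell_small φ (x, 0) q).abs_vec_le F _
    rw [he]
    refine (hrd _ (hle.trans hM1)).trans ?_
    have : 0 < M⁻¹ := by positivity
    nlinarith
  have hCC : C ^ d * (C * (2 * C)) ≤ (2 * C) ^ (d + 3) := by
    have : C ^ d * (C * (2 * C)) ≤ (2 * C) ^ d * (2 * C) ^ 3 := by
      gcongr
      · linarith
      · nlinarith [mul_pos (by linarith : 0 < C) (by linarith : 0 < C)]
    rwa [← pow_add] at this
  have hCd : 1 ≤ C ^ d := one_le_pow₀ hC1
  have hC2 : C ≤ 2 * C := by linarith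
  have hCC2 : C ≤ C * (2 * C) := le_mul_of_one_le_right (by linarith) (by linarith)
  have hg1 := hgood.mono hCC
  have hiter := iterate_close F op E EJ k φ norm hC1 hC₁ x hinit d
    (hg1.mono (le_mul_of_one_le_right (by linarith) (hC1.trans hCC2)))
  have hg2 := hg1.scale hCd (by linarith)
  have hlast := hC₂ ⟨(x, d), rd, C ^ d * (n * M⁻¹), _, hiter⟩ (hg2.mono hCC2)
  have hg3 := hg2.scale hC1 (by linarith)
  have hbound : 2 * C * (C * (C ^ d * (n * M⁻¹))) ≤ 1 := hg3.e_le (by linarith)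
  have hlogit : ∀ v, |(transformer F op E EJ k φ).logits norm rd d (prompt x) v
      - idealLogit (F (φ x)) (tokenClass v)| ≤ 1 / 2 := fun v => by
    have := hC₃ (tokenClass v) ⟨(x, d), rd, C * (C ^ d * (n * M⁻¹)), _, hlast⟩ (hg3.mono hC2)
    -- The token `$` has a position of its own, so the window there must have length at least n + 1.
    -- 2^d ≥ n may fall short, but the round in the final layers gives 2^(d+1) ≥ 2n ≥ n + 1.
    have hwin : window x (d + 1) (x.length + 1) = x := by
      rw [window, List.take_of_length_le (by omega)]
      rcases Nat.eq_zero_or_pos x.length with h | h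
      · rw [List.length_eq_zero_iff.1 h]
        simp
      · have := le_two_pow_logDepth h
        rw [← hd] at this
        have h' : x.length + 1 - 2 ^ (d + 1) = 0 := by
          rw [pow_succ]
          omega
        rw [h', List.drop_zero]
    refine le_trans (le_of_eq ?_) (this.trans (by dsimp only; linarith))
    rw [transformer_logits]
    simp only [nextCell, roundCell, Fin.val_last, hwin]
  have hout := outputs_of_logits F op E EJ k φ norm hlogit
  constructor
  · intro hx
    rwa [(hL x).1 hx] at hout
  · intro hx
    refine ⟨Token.bos, by simp [transformer], ?_⟩
    have : F (φ x) = false := by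
      rw [← Bool.not_eq_true, ← hL]
      exact hx
    rwa [this] at hout

end Correctness

/-! ### Dimensions -/

/-- The slots are padded to a perfect square, and doubled for the negated copies. -/
def modelDim (B : ℕ) : ℕ := 2 * (Nat.sqrt (2 * B + 13) + 1) ^ 2

def ffWidth (B : ℕ) : ℕ := 2 ^ B * 2 ^ B + (Nat.sqrt (2 * B + 13) + 1) ^ 2

lemma sqrt_add_one_sq_le (B : ℕ) : (Nat.sqrt (2 * B + 13) + 1) ^ 2 ≤ 8 * B + 52 := by
  have h1 : 1 ≤ Nat.sqrt (2 * B + 13) := Nat.le_sqrt.2 (by omega)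
  have h2 := Nat.sqrt_le' (2 * B + 13)
  nlinarith

lemma modelDim_le (B : ℕ) : modelDim B ≤ 16 * B + 104 := by
  have := sqrt_add_one_sq_le B
  unfold modelDim
  omega

lemma ffWidth_le (B : ℕ) : ffWidth B ≤ 61 * 2 ^ (2 * B) := by
  have h1 := sqrt_add_one_sq_le B
  have h2 : 2 * B < 2 ^ (2 * B) := Nat.lt_two_pow_self
  have h3 : ffWidth B = 2 ^ (2 * B) + (Nat.sqrt (2 * B + 13) + 1) ^ 2 := by
    rw [ffWidth, ← pow_add, ← two_mul]
  omega

/-- A language that is determined by `B` bits which can be composed. -/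
theorem exists_recognizer (norm : NormKind) {B : ℕ} {α : Type u} {L : Language α}
    (φ : List α → Fin B → Bool) (op : (Fin B → Bool) → (Fin B → Bool) → Fin B → Bool)
    (F : (Fin B → Bool) → Bool) (hφ : ∀ u v, φ (u ++ v) = op (φ u) (φ v))
    (hL : ∀ x, x ∈ L ↔ F (φ x) = true) :
    ∃ T : UniversalTransformer (Token α) 0 8 9 (modelDim B) (ffWidth B),
      T.Recognizes norm logDepth L := by
  set k := Nat.sqrt (2 * B + 13) + 1 with hk
  have hle : 2 * B + 13 ≤ k ^ 2 := (Nat.lt_succ_sqrt' _).le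
  obtain ⟨l, hl⟩ := Nat.exists_eq_add_of_le hle
  have hm : Fintype.card (Slot B l × Bool) = modelDim B := by
    rw [Fintype.card_prod, Slot.card_eq, Fintype.card_bool, ← hl, modelDim, ← hk, mul_comm]
  have hw : Fintype.card (Hidden B l) = ffWidth B := by
    simp only [Hidden, Fintype.card_sum, Fintype.card_prod, Fintype.card_fun, Fintype.card_bool,
      Fintype.card_fin, Slot.card_eq, ffWidth]
    rw [← hl, hk]
  exact ⟨transformer F op (Fintype.equivFinOfCardEq hm) (Fintype.equivFinOfCardEq hw) k φ,
    transformer_recognizes F op _ _ k φ norm (Nat.succ_pos _) hl.symm hφ hL⟩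

/-! ### Automata -/

open Classical in
theorem exists_recognizer_nfa (norm : NormKind) {α : Type u} {Q : Type v} [Fintype Q]
    (M : NFA α Q) :
    ∃ T : UniversalTransformer (Token α) 0 8 9 (modelDim (Fintype.card Q ^ 2))
      (ffWidth (Fintype.card Q ^ 2)), T.Recognizes norm logDepth M.accepts := by
  have e : Q × Q ≃ Fin (Fintype.card Q ^ 2) :=
    Fintype.equivFinOfCardEq (by rw [Fintype.card_prod, sq])
  have hmem : ∀ (S : Set Q) (w : List α) (j : Q),
      j ∈ M.evalFrom S w ↔ ∃ i ∈ S, j ∈ M.evalFrom {i} w := fun S w j => by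
    rw [M.mem_evalFrom_iff_exists]
  -- Bits are the entries of the reachability matrix, composed by Boolean matrix multiplication.
  refine exists_recognizer norm
    (fun w a => decide ((e.symm a).2 ∈ M.evalFrom {(e.symm a).1} w))
    (fun u v a => decide (∃ s, u (e ((e.symm a).1, s)) = true ∧ v (e (s, (e.symm a).2)) = true))
    (fun u => decide (∃ i ∈ M.start, ∃ j ∈ M.accept, u (e (i, j)) = true)) (fun u v => ?_)
    (fun x => ?_)
  · funext a
    simp only [NFA.evalFrom_append, Equiv.symm_apply_apply, decide_eq_true_eq, decide_eq_decide]
    exact hmem _ _ _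
  · simp only [NFA.mem_accepts, Equiv.symm_apply_apply, decide_eq_true_eq]
    constructor
    · rintro ⟨j, hj, hx⟩
      obtain ⟨i, hi, hx⟩ := (hmem _ _ _).1 hx
      exact ⟨i, hi, j, hj, hx⟩
    · rintro ⟨i, hi, j, hj, hx⟩
      exact ⟨j, hj, (hmem _ _ _).2 ⟨i, hi, hx⟩⟩

open Classical in
theorem exists_recognizer_dfa (norm : NormKind) {α : Type u} {Q : Type v} [Fintype Q]
    (M : DFA α Q) :
    ∃ T : UniversalTransformer (Token α) 0 8 9
      (modelDim (Fintype.card Q * (Nat.log 2 (Fintype.card Q) + 1)))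
      (ffWidth (Fintype.card Q * (Nat.log 2 (Fintype.card Q) + 1))),
      T.Recognizes norm logDepth M.accepts := by
  set b := Nat.log 2 (Fintype.card Q) + 1 with hb
  have : Nonempty Q := ⟨M.start⟩
  have e : Q × Fin b ≃ Fin (Fintype.card Q * b) := Fintype.equivFinOfCardEq (by simp)
  obtain ⟨enc⟩ : Nonempty (Q ↪ (Fin b → Bool)) := Function.Embedding.nonempty_of_card_le (by
    simpa using (Nat.lt_pow_succ_log_self one_lt_two (Fintype.card Q)).le)
  -- The value on strings that encode no state is arbitrary and never matters.
  let dec : (Fin b → Bool) → Q := Function.invFun enc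
  have hdec : ∀ q, dec (fun c => enc q c) = q := Function.leftInverse_invFun enc.injective
  -- Composition of transition functions: decode the state reached by `u`, then look up its entry in
  -- the table of `v`.
  refine exists_recognizer norm
    (fun w a => enc (M.evalFrom (e.symm a).1 w) (e.symm a).2)
    (fun u v a => v (e (dec fun c => u (e ((e.symm a).1, c)), (e.symm a).2)))
    (fun u => decide ((dec fun c => u (e (M.start, c))) ∈ M.accept)) (fun u v => ?_)
    (fun x => ?_)
  · funext a
    simp only [Equiv.symm_apply_apply, hdec, DFA.evalFrom_of_append]
  · simp only [Equiv.symm_apply_apply, hdec, decide_eq_true_eq, DFA.mem_accepts]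
    rfl

/-! ### Growth of the dimensions -/

lemma modelDim_nfa_isBigO :
    (fun q : ℕ => (modelDim (q ^ 2) : ℝ)) =O[atTop] fun q : ℕ => (q : ℝ) ^ 2 := by
  refine IsBigO.of_bound 120 (eventually_atTop.2 ⟨1, fun q hq => ?_⟩)
  have h1 : (modelDim (q ^ 2) : ℝ) ≤ 16 * (q : ℝ) ^ 2 + 104 := by
    exact_mod_cast modelDim_le (q ^ 2)
  have h2 : (1 : ℝ) ≤ (q : ℝ) ^ 2 := one_le_pow₀ (by exact_mod_cast hq)
  rw [Real.norm_of_nonneg (by positivity), Real.norm_of_nonneg (by positivity)]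
  linarith

lemma ffWidth_nfa_isBigO :
    (fun q : ℕ => (ffWidth (q ^ 2) : ℝ)) =O[atTop] fun q : ℕ => (2 : ℝ) ^ (q ^ 4) := by
  refine IsBigO.of_bound 61 (eventually_atTop.2 ⟨2, fun q hq => ?_⟩)
  have h1 : (ffWidth (q ^ 2) : ℝ) ≤ 61 * 2 ^ (2 * q ^ 2) := by
    exact_mod_cast ffWidth_le (q ^ 2)
  have h2 : 2 * q ^ 2 ≤ q ^ 4 := by
    have : q ^ 4 = q ^ 2 * q ^ 2 := by ring
    rw [this]
    exact Nat.mul_le_mul_right _ (by nlinarith)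
  rw [Real.norm_of_nonneg (by positivity), Real.norm_of_nonneg (by positivity)]
  refine h1.trans ?_
  gcongr
  exact one_le_two

/-- The number of bits of a transition function is at most `2 q log₂ q`. -/
lemma dfa_bits_le {q : ℕ} (hq : 4 ≤ q) :
    8 ≤ (q : ℝ) * Real.logb 2 q ∧
      ((q * (Nat.log 2 q + 1) : ℕ) : ℝ) ≤ 2 * ((q : ℝ) * Real.logb 2 q) := by
  have hq' : (4 : ℝ) ≤ q := by exact_mod_cast hq
  have h2 : 2 ≤ Real.logb 2 q := by
    rw [Real.le_logb_iff_rpow_le one_lt_two (by linarith)]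
    norm_num
    exact hq
  refine ⟨by nlinarith, ?_⟩
  have h3 : (Nat.log 2 q : ℝ) ≤ Real.logb 2 q := by exact_mod_cast Real.natLog_le_logb q 2
  push_cast
  nlinarith

lemma modelDim_dfa_isBigO :
    (fun q : ℕ => (modelDim (q * (Nat.log 2 q + 1)) : ℝ)) =O[atTop]
      fun q : ℕ => (q : ℝ) * Real.logb 2 q := by
  refine IsBigO.of_bound 45 (eventually_atTop.2 ⟨4, fun q hq => ?_⟩)
  obtain ⟨h8, hB⟩ := dfa_bits_le hq
  have h1 : (modelDim (q * (Nat.log 2 q + 1)) : ℝ)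
      ≤ 16 * ((q * (Nat.log 2 q + 1) : ℕ) : ℝ) + 104 := by
    exact_mod_cast modelDim_le (q * (Nat.log 2 q + 1))
  rw [Real.norm_of_nonneg (by positivity), Real.norm_of_nonneg (by linarith)]
  linarith

lemma ffWidth_dfa_isBigO :
    (fun q : ℕ => (ffWidth (q * (Nat.log 2 q + 1)) : ℝ)) =O[atTop]
      fun q : ℕ => (2 : ℝ) ^ ((q : ℝ) ^ 2 * Real.logb 2 q ^ 2) := by
  refine IsBigO.of_bound 61 (eventually_atTop.2 ⟨4, fun q hq => ?_⟩)
  obtain ⟨h8, hB⟩ := dfa_bits_le hq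
  have h1 : (ffWidth (q * (Nat.log 2 q + 1)) : ℝ)
      ≤ 61 * (2 : ℝ) ^ (2 * (q * (Nat.log 2 q + 1))) := by
    exact_mod_cast ffWidth_le (q * (Nat.log 2 q + 1))
  rw [Real.norm_of_nonneg (by positivity), Real.norm_of_nonneg (by positivity)]
  refine h1.trans ?_
  rw [← Real.rpow_natCast]
  gcongr
  · exact one_le_two
  -- With X = q log₂ q ≥ 8 the exponent satisfies 2B ≤ 4X ≤ X².
  · rw [Nat.cast_mul, ← mul_pow]
    push_cast at hB ⊢
    nlinarith

end LogDepth

end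

theorem mainTheorem1 (norm : LogDepth.NormKind) :
    (∃ mNFA wNFA : ℕ → ℕ,
      ((fun q : ℕ => (mNFA q : ℝ)) =O[atTop] fun q : ℕ => (q : ℝ) ^ 2) ∧
      ((fun q : ℕ => (wNFA q : ℝ)) =O[atTop] fun q : ℕ => (2 : ℝ) ^ (q ^ 4)) ∧
      ∀ (α : Type u) (Q : Type v) [Fintype α] [Fintype Q] (M : NFA α Q),
        ∃ T : LogDepth.UniversalTransformer (LogDepth.Token α) 0 8 9
            (mNFA (Fintype.card Q)) (wNFA (Fintype.card Q)),
          T.Recognizes norm LogDepth.logDepth M.accepts) ∧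
    (∃ mDFA wDFA : ℕ → ℕ,
      ((fun q : ℕ => (mDFA q : ℝ)) =O[atTop] fun q : ℕ => (q : ℝ) * Real.logb 2 q) ∧
      ((fun q : ℕ => (wDFA q : ℝ)) =O[atTop]
        fun q : ℕ => (2 : ℝ) ^ ((q : ℝ) ^ 2 * Real.logb 2 q ^ 2)) ∧
      ∀ (α : Type u) (Q : Type v) [Fintype α] [Fintype Q] (M : DFA α Q),
        ∃ T : LogDepth.UniversalTransformer (LogDepth.Token α) 0 8 9
            (mDFA (Fintype.card Q)) (wDFA (Fintype.card Q)),
          T.Recognizes norm LogDepth.logDepth M.accepts) :=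
  ⟨⟨fun q => LogDepth.modelDim (q ^ 2), fun q => LogDepth.ffWidth (q ^ 2),
    LogDepth.modelDim_nfa_isBigO, LogDepth.ffWidth_nfa_isBigO,
    fun _ _ _ _ M => LogDepth.exists_recognizer_nfa norm M⟩,
  ⟨fun q => LogDepth.modelDim (q * (Nat.log 2 q + 1)),
    fun q => LogDepth.ffWidth (q * (Nat.log 2 q + 1)),
    LogDepth.modelDim_dfa_isBigO, LogDepth.ffWidth_dfa_isBigO,
    fun _ _ _ _ M => LogDepth.exists_recognizer_dfa norm M⟩⟩
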